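/- Let $R$ be a countable nonzero ring with unit (not necessarily commutative), and let $R[x]$ be the ring of polynomials over $R$ in an indeterminate $x$ commuting with the elements of $R$. Then the theory of left $R[x]$-modules, in the language $\{+,0,\cdot_s\}_{s\in R[x]}$, is Borel complete. Here, for a countable language $\mathcal L$, $Str_{\mathcal L}$ is the Polish space of all $\mathcal L$-structures with universe $\omega$ (with its usual topology), and for a countable set $T$ of $\mathcal L_{\omega_1\omega}$-sentences $\mathrm{Mod}(T)\subseteq Str_{\mathcal L}$ is the set of models of $T$ with universe $\omega$. A theory $S$ in a countable language $\mathcal L'$ is Borel reducible to $T$, written $S\le_B T$, if there is a Borel function $f:\mathrm{Mod}(S)\to\mathrm{Mod}(T)$ such that for all $M,N\in\mathrm{Mod}(S)$, $f(M)\cong_{\mathcal L} f(N)$ if and only if $M\cong_{\mathcal L'} N$. The theory $T$ is Borel complete if $S\le_B T$ for every countable language $\mathcal L'$ and every countable set $S$ of $\mathcal L'_{\omega_1\omega}$-sentences. -/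

import Mathlib

universe u v u' v'

namespace BorelComplexity

/-- Formulas of the infinitary logic `L_{ω₁ω}` whose free variables are among `x_0, …, x_{n-1}`:
first-order formation rules together with countable conjunctions. In `all φ`, the variable bound by
the quantifier is the last variable `x_n` of `φ`. (A subformula of an `L_{ω₁ω}`-sentence only has
finitely many free variables, so all sentences are of this form up to renaming bound variables.) -/
inductive InfFormula (L : FirstOrder.Language.{u, v}) : ℕ → Type (max u v)
  | falsum {n : ℕ} : InfFormula L n
  | equal {n : ℕ} (s t : L.Term (Fin n)) : InfFormula L n
  | rel {n k : ℕ} (r : L.Relations k) (ts : Fin k → L.Term (Fin n)) : InfFormula L n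
  | imp {n : ℕ} (φ ψ : InfFormula L n) : InfFormula L n
  | all {n : ℕ} (φ : InfFormula L (n + 1)) : InfFormula L n
  | conj {n : ℕ} (φ : ℕ → InfFormula L n) : InfFormula L n

namespace InfFormula

variable {L : FirstOrder.Language.{u, v}}

/-- Negation. -/
def neg {n : ℕ} (φ : InfFormula L n) : InfFormula L n := imp φ falsum

/-- Existential quantification. -/
def ex {n : ℕ} (φ : InfFormula L (n + 1)) : InfFormula L n := neg (all (neg φ))

/-- Satisfaction of a formula in a structure under an assignment of its free variables. -/
def Realize {M : Type*} [L.Structure M] : {n : ℕ} → InfFormula L n → (Fin n → M) → Prop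
  | _, falsum, _ => False
  | _, equal s t, a => s.realize a = t.realize a
  | _, rel r ts, a => FirstOrder.Language.Structure.RelMap r (fun i => (ts i).realize a)
  | _, imp φ ψ, a => φ.Realize a → ψ.Realize a
  | _, all φ, a => ∀ x : M, φ.Realize (Fin.snoc a x)
  | _, conj φ, a => ∀ i : ℕ, (φ i).Realize a

end InfFormula

/-- `L_{ω₁ω}`-sentences. -/
abbrev InfSentence (L : FirstOrder.Language.{u, v}) : Type (max u v) := InfFormula L 0

/-- The space of all `L`-structures with universe `ω = ℕ`. -/
def Str (L : FirstOrder.Language.{u, v}) : Type (max u v) := L.Structure ℕ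

/-- The usual topology on `Str L`: the coarsest one such that, for every function symbol `f`
(relation symbol `r`) and every tuple `a` from `ℕ`, the value `f(a)` in `ℕ` (the truth value of
`r(a)`) depends continuously on the structure, values being taken in discrete spaces. -/
instance (L : FirstOrder.Language.{u, v}) : TopologicalSpace (Str L) :=
  (⨅ (n : ℕ) (f : L.Functions n) (a : Fin n → ℕ),
    TopologicalSpace.induced (fun M : Str L => @FirstOrder.Language.Structure.funMap L ℕ M n f a) ⊥) ⊓
  (⨅ (n : ℕ) (r : L.Relations n) (a : Fin n → ℕ),
    TopologicalSpace.induced (fun M : Str L => @FirstOrder.Language.Structure.RelMap L ℕ M n r a) ⊥)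

/-- `Str L` carries its Borel σ-algebra. -/
instance (L : FirstOrder.Language.{u, v}) : MeasurableSpace (Str L) := borel (Str L)

/-- Isomorphism of `L`-structures with universe `ℕ`. -/
def Iso {L : FirstOrder.Language.{u, v}} (M N : Str L) : Prop :=
  Nonempty (@FirstOrder.Language.Equiv L ℕ ℕ M N)

/-- `Mod T`: the structures with universe `ℕ` satisfying every sentence in `T`, with the σ-algebra
inherited from `Str L` (the Borel sets of the subspace topology). -/
def Mod {L : FirstOrder.Language.{u, v}} (T : Set (InfSentence L)) : Set (Str L) :=
  {M | ∀ φ ∈ T, @InfFormula.Realize L ℕ M 0 φ Fin.elim0}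

/-- Borel reducibility `S ≤_B T` of theories. -/
def BorelReducible {L' : FirstOrder.Language.{u', v'}} {L : FirstOrder.Language.{u, v}}
    (S : Set (InfSentence L')) (T : Set (InfSentence L)) : Prop :=
  ∃ f : Mod S → Mod T, Measurable f ∧
    ∀ M N : Mod S, Iso (f M : Str L) (f N : Str L) ↔ Iso (M : Str L') (N : Str L')

/-- `T` is Borel complete if it is maximal for Borel reducibility: every countable
`L_{ω₁ω}`-theory in a countable language is Borel reducible to `T`. -/
def BorelComplete {L : FirstOrder.Language.{u, v}} (T : Set (InfSentence L)) : Prop :=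
  ∀ (L' : FirstOrder.Language.{u', v'}), Countable L'.Symbols →
    ∀ S : Set (InfSentence L'), S.Countable → BorelReducible S T

/-- Function symbols of the language of left `R`-modules: a constant `0`, a binary `+`, and a
unary symbol for scalar multiplication by each `r : R`. -/
inductive ModuleFunc (R : Type u) : ℕ → Type u
  | zero : ModuleFunc R 0
  | add : ModuleFunc R 2
  | smul (r : R) : ModuleFunc R 1

/-- The language `{+, 0, ·_r}_{r ∈ R}` of left `R`-modules. -/
def moduleLang (R : Type u) : FirstOrder.Language.{u, 0} := ⟨ModuleFunc R, fun _ => Empty⟩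

section ModuleTheory

variable {R : Type u} {n : ℕ}

/-- The term `0`. -/
def tZero : (moduleLang R).Term (Fin n) :=
  FirstOrder.Language.Term.func (l := 0) (ModuleFunc.zero : ModuleFunc R 0) Fin.elim0

/-- The term `s + t`. -/
def tAdd (s t : (moduleLang R).Term (Fin n)) : (moduleLang R).Term (Fin n) :=
  FirstOrder.Language.Term.func (l := 2) (ModuleFunc.add : ModuleFunc R 2) ![s, t]

/-- The term `r · t`. -/
def tSMul (r : R) (t : (moduleLang R).Term (Fin n)) : (moduleLang R).Term (Fin n) :=
  FirstOrder.Language.Term.func (l := 1) (ModuleFunc.smul r : ModuleFunc R 1) ![t]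

/-- The variable `x_i`. -/
def tVar (i : Fin n) : (moduleLang R).Term (Fin n) := FirstOrder.Language.Term.var i

open InfFormula in
/-- The axioms of left `R`-modules. -/
inductive ModuleAxiom (R : Type u) [Ring R] : InfSentence (moduleLang R) → Prop
  | add_assoc : ModuleAxiom R (all (all (all
      (equal (tAdd (tAdd (tVar 0) (tVar 1)) (tVar 2)) (tAdd (tVar 0) (tAdd (tVar 1) (tVar 2)))))))
  | add_comm : ModuleAxiom R (all (all
      (equal (tAdd (tVar 0) (tVar 1)) (tAdd (tVar 1) (tVar 0)))))
  | add_zero : ModuleAxiom R (all (equal (tAdd (tVar 0) tZero) (tVar 0)))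
  | add_neg : ModuleAxiom R (all (ex (equal (tAdd (tVar 0) (tVar 1)) tZero)))
  | smul_add (r : R) : ModuleAxiom R (all (all
      (equal (tSMul r (tAdd (tVar 0) (tVar 1))) (tAdd (tSMul r (tVar 0)) (tSMul r (tVar 1))))))
  | add_smul (r s : R) : ModuleAxiom R (all
      (equal (tSMul (r + s) (tVar 0)) (tAdd (tSMul r (tVar 0)) (tSMul s (tVar 0)))))
  | mul_smul (r s : R) : ModuleAxiom R (all
      (equal (tSMul (r * s) (tVar 0)) (tSMul r (tSMul s (tVar 0)))))
  | one_smul : ModuleAxiom R (all (equal (tSMul 1 (tVar 0)) (tVar 0)))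

end ModuleTheory

/-- The theory of left `R`-modules. -/
def moduleTheory (R : Type u) [Ring R] : Set (InfSentence (moduleLang R)) :=
  {φ | ModuleAxiom R φ}

end BorelComplexity

/-! A structure on `ℕ` is coded by a submodule of one fixed countable module, in such a way that
every isomorphism between two codes comes from a permutation of `ℕ`.

Let `S` be a simple left `R`-module and `V` the module `S[x]` with a sequence of pairwise comaximal
monic integer polynomials `p j` inverted. The `p j` are central, act bijectively on `V`, and are
told apart by divisibility in submodules; moreover a nonzero endomorphism of `V` is injective
(`denominatorSystem`). Given idempotent partial maps `r j` of an index set `I`, take the submodule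
of `I →₀ V` spanned by the basis vectors `e_b` (with value `gen`) and all quotients of `e_b - r j
e_b` by powers of a denominator reserved for `j`. Its elements divisible by all these powers recover
the kernel of `r j` up to denominators, so an isomorphism of two such modules extends to an
automorphism of `I →₀ V` matching all the kernels (`exists_linearEquiv_of_tagModule`). Kernels can
express sorts, unary predicates and graphs of maps.

A linear automorphism need not permute the basis, however. On a copy of a group `Γ` whose right
translations are expressible, it is a unit of the group ring of `Γ` over `End V`; if `Γ` has two
unique products, such a unit is concentrated at one `δ` (`exists_single_of_equivariant`). A single
copy of a countable `Γ` yields too few permutations, so there is one copy for each `n`, giving a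
sequence `δ n`; a sort of eventually constant sequences in a `Γ`-set `X` forces `δ n` to converge
pointwise on `X`. Isomorphisms of codes thus correspond to limits of elements of `Γ` preserving the
coded predicates (`nonempty_codeModule_equiv_iff`).

It remains to find a countable `Γ` with two unique products acting on `ℕ` with dense image in the
symmetric group. The action cannot be faithful on transpositions, which are torsion; they are lifted
to order automorphisms of a coloured `ℚ` (`exists_countable_group_dense_perm`). With `X` the finite
lists of naturals and the graphs of the symbols as predicates, limits of `Γ` are exactly what
isomorphisms of structures require (`iso_iff_exists_limit`). -/

namespace BorelComplexity

/-! ### Back-and-forth for densely coloured rationals -/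

section ColoredRationals

/-- A colouring of the rationals by the natural numbers, with every colour class dense. -/
def ratColor (q : ℚ) : ℕ := (padicValRat 2 q).toNat

/-- The numbers `2 ^ c * odd / 3 ^ n` have 2-adic valuation `c`, and their spacing `2 * 2 ^ c / 3 ^
n` drops below `b - a` for large `n`. -/
theorem exists_ratColor_eq_between {a b : ℚ} (hab : a < b) (c : ℕ) :
    ∃ q, a < q ∧ q < b ∧ ratColor q = c := by
  obtain ⟨n, hn⟩ := pow_unbounded_of_one_lt (2 * 2 ^ c / (b - a)) (by norm_num : (1 : ℚ) < 3)
  have hba : 0 < b - a := sub_pos.2 hab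
  have h2 : (0 : ℚ) < 2 ^ c := by positivity
  have h3 : (0 : ℚ) < 3 ^ n := by positivity
  set t : ℚ := 3 ^ n / 2 ^ c with ht
  have htpos : 0 < t := by positivity
  have hlen : 2 < (b - a) * t := by
    rw [div_lt_iff₀ hba] at hn
    rw [ht, mul_div_assoc', lt_div_iff₀ h2]
    linarith
  -- The least `j` with `a * t < 2 * j + 1`; then `2 * j + 1 ≤ a * t + 2 < b * t`.
  set j : ℤ := ⌊(a * t - 1) / 2⌋ + 1 with hj
  have hj1 : (a * t - 1) / 2 < j := by rw [hj]; push_cast; exact Int.lt_floor_add_one _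
  have hj2 : (j : ℚ) ≤ (a * t - 1) / 2 + 1 := by
    rw [hj]; push_cast; linarith [Int.floor_le ((a * t - 1) / 2)]
  have hq : ((2 * j + 1 : ℤ) : ℚ) / t = (2 : ℚ) ^ c * ((2 * j + 1 : ℤ) : ℚ) / 3 ^ n := by
    rw [ht]; field_simp
  refine ⟨((2 * j + 1 : ℤ) : ℚ) / t, ?_, ?_, ?_⟩
  · rw [lt_div_iff₀ htpos]; push_cast; linarith
  · rw [div_lt_iff₀ htpos]; push_cast; linarith
  · have hodd : ((2 * j + 1 : ℤ) : ℚ) ≠ 0 := by exact_mod_cast (by omega : 2 * j + 1 ≠ 0)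
    have : Fact (Nat.Prime 2) := ⟨Nat.prime_two⟩
    have e1 : padicValRat 2 ((2 * j + 1 : ℤ) : ℚ) = 0 := by
      rw [padicValRat.of_int, padicValInt.eq_zero_of_not_dvd (by omega)]; rfl
    have e2 : padicValRat 2 ((3 : ℚ) ^ n) = 0 := by
      rw [padicValRat.pow]
      have : padicValRat 2 (3 : ℚ) = 0 := by
        have := padicValRat.of_nat (p := 2) (n := 3)
        rw [padicValNat.eq_zero_of_not_dvd (by norm_num)] at this
        exact_mod_cast this
      rw [this, mul_zero]
    have e3 : padicValRat 2 ((2 : ℚ) ^ c) = c := by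
      rw [padicValRat.pow]
      have := padicValRat.self (p := 2) (by norm_num)
      push_cast at this
      rw [this, mul_one]
    rw [ratColor, hq, padicValRat.div (by positivity) (by positivity),
      padicValRat.mul (by positivity) hodd, e1, e2, e3]
    simp

theorem exists_ratColor_eq_between_finsets (lo hi : Finset ℚ)
    (h : ∀ x ∈ lo, ∀ y ∈ hi, x < y) (c : ℕ) :
    ∃ m, (∀ x ∈ lo, x < m) ∧ (∀ y ∈ hi, m < y) ∧ ratColor m = c := by
  obtain ⟨m, hm1, hm2⟩ := Order.exists_between_finsets lo hi h
  -- Either finset may be empty, so a second separating point is used to get a nonempty open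
  -- interval `(m, m')`.
  obtain ⟨m', hm1', hm2'⟩ := Order.exists_between_finsets (insert m lo) hi (by
    intro x hx y hy
    rcases Finset.mem_insert.1 hx with rfl | hx
    exacts [hm2 y hy, h x hx y hy])
  obtain ⟨q, hq1, hq2, hq3⟩ := exists_ratColor_eq_between (hm1' m (Finset.mem_insert_self _ _)) c
  exact ⟨q, fun x hx => (hm1 x hx).trans hq1, fun y hy => hq2.trans (hm2' y hy), hq3⟩

/-- Finite partial order isomorphisms of `ℚ` that permute the colours through `π`. -/
def ColorPartialIso (π : Equiv.Perm ℕ) : Type :=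
  {f : Finset (ℚ × ℚ) // (∀ p ∈ f, ∀ q ∈ f, cmp p.1 q.1 = cmp p.2 q.2) ∧
    ∀ p ∈ f, ratColor p.2 = π (ratColor p.1)}

namespace ColorPartialIso

variable {π : Equiv.Perm ℕ}

instance : Preorder (ColorPartialIso π) := Preorder.lift Subtype.val

theorem exists_across (f : ColorPartialIso π) (a : ℚ) :
    ∃ b, (∀ p ∈ f.val, cmp p.1 a = cmp p.2 b) ∧ ratColor b = π (ratColor a) := by
  by_cases h : ∃ b, (a, b) ∈ f.val
  · obtain ⟨b, hb⟩ := h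
    exact ⟨b, fun p hp => f.2.1 _ hp _ hb, f.2.2 _ hb⟩
  have key : ∀ x ∈ {p ∈ f.val | p.1 < a}.image Prod.snd,
      ∀ y ∈ {p ∈ f.val | a < p.1}.image Prod.snd, x < y := by
    intro x hx y hy
    rw [Finset.mem_image] at hx hy
    rcases hx with ⟨p, hp1, rfl⟩
    rcases hy with ⟨q, hq1, rfl⟩
    rw [Finset.mem_filter] at hp1 hq1
    rw [← lt_iff_lt_of_cmp_eq_cmp (f.2.1 _ hp1.1 _ hq1.1)]
    exact hp1.2.trans hq1.2
  obtain ⟨b, hb1, hb2, hb3⟩ := exists_ratColor_eq_between_finsets _ _ key (π (ratColor a))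
  refine ⟨b, ?_, hb3⟩
  rintro ⟨p1, p2⟩ hp
  have hne : p1 ≠ a := fun he => h ⟨p2, he ▸ hp⟩
  rcases lt_or_gt_of_ne hne with hl | hr
  · have h2 : p2 < b := hb1 _ (Finset.mem_image.2 ⟨_, Finset.mem_filter.2 ⟨hp, hl⟩, rfl⟩)
    exact ((cmp_eq_lt_iff _ _).2 hl).trans ((cmp_eq_lt_iff _ _).2 h2).symm
  · have h2 : b < p2 := hb2 _ (Finset.mem_image.2 ⟨_, Finset.mem_filter.2 ⟨hp, hr⟩, rfl⟩)
    exact ((cmp_eq_gt_iff _ _).2 hr).trans ((cmp_eq_gt_iff _ _).2 h2).symm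

theorem exists_extend_left (f : ColorPartialIso π) (a : ℚ) :
    ∃ g : ColorPartialIso π, (∃ b, (a, b) ∈ g.val) ∧ f ≤ g := by
  obtain ⟨b, hb, hc⟩ := exists_across f a
  refine ⟨⟨insert (a, b) f.val, ?_, ?_⟩, ⟨b, Finset.mem_insert_self _ _⟩,
    Finset.subset_insert _ _⟩
  · intro p hp q hq
    rw [Finset.mem_insert] at hp hq
    rcases hp with rfl | pf <;> rcases hq with rfl | qf
    · simp only [cmp_self_eq_eq]
    · rw [cmp_eq_cmp_symm]; exact hb _ qf
    · exact hb _ pf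
    · exact f.2.1 _ pf _ qf
  · intro p hp
    rcases Finset.mem_insert.1 hp with rfl | pf
    exacts [hc, f.2.2 _ pf]

/-- The inverse of a finite partial isomorphism. -/
def inv (f : ColorPartialIso π) : ColorPartialIso π⁻¹ :=
  ⟨f.val.image Prod.swap, by
    constructor
    · intro p hp q hq
      obtain ⟨p', hp', rfl⟩ := Finset.mem_image.1 hp
      obtain ⟨q', hq', rfl⟩ := Finset.mem_image.1 hq
      exact (f.2.1 _ hp' _ hq').symm
    · intro p hp
      obtain ⟨p', hp', rfl⟩ := Finset.mem_image.1 hp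
      simp [f.2.2 _ hp']⟩

theorem mem_inv {f : ColorPartialIso π} {a b : ℚ} : (b, a) ∈ f.inv.val ↔ (a, b) ∈ f.val := by
  simp [inv]

theorem exists_extend_right (f : ColorPartialIso π) (b : ℚ) :
    ∃ g : ColorPartialIso π, (∃ a, (a, b) ∈ g.val) ∧ f ≤ g := by
  obtain ⟨g, ⟨a, ha⟩, hg⟩ := exists_extend_left f.inv b
  refine ⟨⟨g.inv.val, by simpa using g.inv.2⟩, ⟨a, mem_inv.2 ha⟩, ?_⟩
  rintro ⟨x, y⟩ hxy
  exact mem_inv.2 (hg (mem_inv.2 hxy))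

end ColorPartialIso

/-- Every permutation of the colours is induced by an order automorphism of the rationals. -/
theorem exists_orderIso_ratColor (π : Equiv.Perm ℕ) :
    ∃ g : ℚ ≃o ℚ, ∀ q, ratColor (g q) = π (ratColor q) := by
  -- An ideal of finite partial isomorphisms meeting these countably many cofinal sets is the graph
  -- of a total bijection.
  let D : ℚ ⊕ ℚ → Order.Cofinal (ColorPartialIso π) := fun s => Sum.recOn s
    (fun a => ⟨{f | ∃ b, (a, b) ∈ f.val}, fun f => by
      obtain ⟨g, h1, h2⟩ := f.exists_extend_left a; exact ⟨g, h1, h2⟩⟩)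
    (fun b => ⟨{f | ∃ a, (a, b) ∈ f.val}, fun f => by
      obtain ⟨g, h1, h2⟩ := f.exists_extend_right b; exact ⟨g, h1, h2⟩⟩)
  let J := Order.idealOfCofinals (⟨∅, by simp, by simp⟩ : ColorPartialIso π) D
  have hF : ∀ a, ∃ b, ∃ f ∈ J, (a, b) ∈ f.val := fun a => by
    obtain ⟨f, ⟨b, hb⟩, hf⟩ := Order.cofinal_meets_idealOfCofinals _ D (Sum.inl a)
    exact ⟨b, f, hf, hb⟩
  have hG : ∀ b, ∃ a, ∃ f ∈ J, (a, b) ∈ f.val := fun b => by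
    obtain ⟨f, ⟨a, ha⟩, hf⟩ := Order.cofinal_meets_idealOfCofinals _ D (Sum.inr b)
    exact ⟨a, f, hf, ha⟩
  choose F hF using hF
  choose G hG using hG
  refine ⟨OrderIso.ofCmpEqCmp F G fun a b => ?_, fun q => ?_⟩
  · obtain ⟨f, hf, ha⟩ := hF a
    obtain ⟨g, hg, hb⟩ := hG b
    obtain ⟨m, -, fm, gm⟩ := J.directed _ hf _ hg
    exact m.2.1 _ (fm ha) _ (gm hb)
  · obtain ⟨f, -, ha⟩ := hF q
    exact f.2.2 _ ha

end ColoredRationals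

/-! ### A countable group with two unique products, dense in the symmetric group -/

section OrderAutomorphisms

/-- Comparing order automorphisms of `ℚ` at the first rational (in a fixed enumeration) at which
they differ shows that their group has two unique products. -/
theorem twoUniqueProds_orderIso_rat : TwoUniqueProds (ℚ ≃o ℚ) := by
  let e : ℕ ≃ ℚ := (Denumerable.eqv ℚ).symm
  let φ : (ℚ ≃o ℚ) → Lex (ℕ → ℚ) := fun g => toLex fun i => g (e i)
  have hφ : Function.Injective φ := fun g h hgh => by
    ext q
    have := congrFun (toLex.injective hgh) (e.symm q)
    simpa using this
  let : LinearOrder (ℚ ≃o ℚ) := LinearOrder.lift' φ hφ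
  -- Composing with `f` on the left keeps the first place of difference, and keeps its direction
  -- since `f` is increasing.
  have : MulLeftStrictMono (ℚ ≃o ℚ) := ⟨fun f g h hgh => by
    obtain ⟨i, hi1, hi2⟩ : φ g < φ h := hgh
    refine (⟨i, fun j hj => ?_, ?_⟩ : φ (f * g) < φ (f * h))
    · exact congrArg f (hi1 j hj)
    · exact f.strictMono hi2⟩
  exact TwoUniqueProds.of_covariant_right

/-- A countable group with two unique products that acts on `ℕ` with dense image in the group of
all permutations. -/
theorem exists_countable_group_dense_perm :
    ∃ (Γ : Type) (_ : Group Γ) (_ : Countable Γ) (_ : TwoUniqueProds Γ) (τ : Γ →* Equiv.Perm ℕ),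
      ∀ (π : Equiv.Perm ℕ) (n : ℕ), ∃ γ : Γ, ∀ a < n, τ γ a = π a := by
  choose g hg using exists_orderIso_ratColor
  let P : Subgroup ((ℚ ≃o ℚ) × Equiv.Perm ℕ) :=
    { carrier := {x | ∀ q, ratColor (x.1 q) = x.2 (ratColor q)}
      mul_mem' := fun {x y} hx hy q => by
        simp only [Set.mem_ofPred_eq] at hx hy
        simp [hx, hy, RelIso.mul_apply]
      one_mem' := fun q => rfl
      inv_mem' := fun {x} hx q => by
        simp only [Set.mem_ofPred_eq] at hx
        have := hx (x.1⁻¹ q)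
        rw [Prod.fst_inv, Prod.snd_inv, Equiv.Perm.eq_inv_iff_eq, ← this, RelIso.apply_inv_self] }
  let Φ : FreeGroup (ℕ × ℕ) →* (ℚ ≃o ℚ) × Equiv.Perm ℕ :=
    FreeGroup.lift fun ij => (g (Equiv.swap ij.1 ij.2), Equiv.swap ij.1 ij.2)
  let H := Φ.range
  have hHP : H ≤ P := by
    refine FreeGroup.range_lift_le ?_
    rintro _ ⟨ij, rfl⟩ q
    exact hg _ q
  have hsurj : Function.Surjective ratColor := fun c => by
    obtain ⟨q, -, -, hq⟩ := exists_ratColor_eq_between (zero_lt_one) c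
    exact ⟨q, hq⟩
  -- An order automorphism determines the permutation of colours it induces, because all colours
  -- occur; hence `H` embeds into the automorphisms of `ℚ`.
  have hinj : Function.Injective ((MonoidHom.fst (ℚ ≃o ℚ) (Equiv.Perm ℕ)).comp H.subtype) := by
    rintro ⟨⟨x1, x2⟩, hx⟩ ⟨⟨y1, y2⟩, hy⟩ hxy
    have h1 : x1 = y1 := hxy
    subst h1
    congr 2
    ext c
    obtain ⟨q, rfl⟩ := hsurj c
    exact (hHP hx q).symm.trans (hHP hy q)
  have := twoUniqueProds_orderIso_rat
  refine ⟨H, inferInstance, ?_, ?_, (MonoidHom.snd _ _).comp H.subtype, ?_⟩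
  · exact Φ.rangeRestrict_surjective.countable
  · exact TwoUniqueProds.of_injective_mulHom
      ((MonoidHom.fst (ℚ ≃o ℚ) (Equiv.Perm ℕ)).comp H.subtype).toMulHom hinj
      inferInstance
  · intro π n
    induction n with
    | zero => exact ⟨1, fun a ha => absurd ha (Nat.not_lt_zero a)⟩
    | succ n ih =>
      obtain ⟨γ, hγ⟩ := ih
      -- The transposition moving `γ n` to `π n` fixes `π a = γ a` for every `a < n`, so the earlier
      -- agreement survives.
      let δ : H := ⟨_, FreeGroup.of (γ.1.2 n, π n), FreeGroup.lift_apply_of⟩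
      refine ⟨δ * γ, fun a ha => ?_⟩
      change Equiv.swap (γ.1.2 n) (π n) (γ.1.2 a) = π a
      rcases Nat.lt_succ_iff_lt_or_eq.1 ha with h | rfl
      · have h1 : γ.1.2 a = π a := hγ a h
        rw [Equiv.swap_apply_of_ne_of_ne, h1]
        · exact fun h' => h.ne (γ.1.2.injective h')
        · rw [h1]; exact fun h' => h.ne (π.injective h')
      · exact Equiv.swap_apply_left _ _

end OrderAutomorphisms

/-! ### Degree arguments in `S[x]` -/

open Polynomial

noncomputable section

/-- The module `S[x]` of polynomials with coefficients in a module `S`, over a possibly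
noncommutative ring. -/
abbrev PolyMod (S : Type*) [Zero S] : Type _ := ℕ →₀ S

namespace PolyMod

variable (R : Type*) [Ring R] (S : Type*) [AddCommGroup S] [Module R S]

/-- Multiplication by the indeterminate on `S[x]`. -/
def shift : AddMonoid.End (PolyMod S) := Finsupp.mapDomain.addMonoidHom Nat.succ

/-- Coefficientwise multiplication by the elements of `R` on `S[x]`. -/
def scalar : R →+* AddMonoid.End (PolyMod S) := Module.toAddMonoidEnd R (PolyMod S)

variable {R S}

theorem shift_pow_single (n k : ℕ) (s : S) :
    (shift S ^ n) (Finsupp.single k s) = Finsupp.single (k + n) s := by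
  induction n with
  | zero => rfl
  | succ n ih =>
    rw [pow_succ']
    change shift S ((shift S ^ n) (Finsupp.single k s)) = _
    rw [ih]
    exact Finsupp.mapDomain_single

theorem commute_scalar_shift (a : R) : Commute (scalar R S a) (shift S) := by
  refine AddMonoidHom.ext fun t => ?_
  change a • Finsupp.mapDomain Nat.succ t = Finsupp.mapDomain Nat.succ (a • t)
  rw [Finsupp.mapDomain_smul]

/-- The coefficients need not commute with each other; evaluation at the shift is a ring
homomorphism because the shift commutes with every coefficient. -/
instance : Module R[X] (PolyMod S) :=
  Module.compHom _ (eval₂RingHom' (scalar R S) (shift S) commute_scalar_shift)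

theorem monomial_smul_single (n k : ℕ) (a : R) (s : S) :
    (monomial n a : R[X]) • (Finsupp.single k s : PolyMod S) = Finsupp.single (k + n) (a • s) := by
  change (eval₂ (scalar R S) (shift S) (monomial n a)) (Finsupp.single k s) = _
  rw [eval₂_monomial]
  change scalar R S a ((shift S ^ n) (Finsupp.single k s)) = _
  rw [shift_pow_single]
  exact Finsupp.smul_single a (k + n) s

theorem C_smul_single (k : ℕ) (a : R) (s : S) :
    (C a : R[X]) • (Finsupp.single k s : PolyMod S) = Finsupp.single k (a • s) :=
  monomial_smul_single 0 k a s

theorem X_pow_smul_single (n : ℕ) (s : S) :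
    (X ^ n : R[X]) • (Finsupp.single 0 s : PolyMod S) = Finsupp.single n s := by
  rw [← monomial_one_right_eq_X_pow, monomial_smul_single, one_smul, zero_add]

theorem smul_single_apply (p : R[X]) (k : ℕ) (s : S) (m : ℕ) :
    (p • (Finsupp.single k s : PolyMod S)) m = if k ≤ m then p.coeff (m - k) • s else 0 := by
  induction p using Polynomial.induction_on' with
  | add p q hp hq =>
    rw [add_smul, Finsupp.add_apply, hp, hq]
    split_ifs <;> simp [add_smul]
  | monomial n a =>
    rw [monomial_smul_single, Finsupp.single_apply, coeff_monomial]
    split_ifs <;> first | rfl | (exfalso; omega) | simp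

theorem C_smul_apply (a : R) (t : PolyMod S) (k : ℕ) : ((C a : R[X]) • t) k = a • t k := by
  induction t using Finsupp.induction_linear with
  | zero => simp
  | add s t hs ht => rw [smul_add, Finsupp.add_apply, hs, ht, Finsupp.add_apply, smul_add]
  | single n s =>
    rw [C_smul_single, Finsupp.single_apply, Finsupp.single_apply]
    split_ifs <;> simp

/-- `t` has degree `D`. -/
def HasDegree (t : PolyMod S) (D : ℕ) : Prop := t D ≠ 0 ∧ ∀ k, D < k → t k = 0

theorem exists_hasDegree {t : PolyMod S} (ht : t ≠ 0) : ∃ D, HasDegree t D := by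
  have hne : t.support.Nonempty := Finsupp.support_nonempty_iff.2 ht
  refine ⟨_, Finsupp.mem_support_iff.1 (Finset.max'_mem _ hne), fun k hk => ?_⟩
  by_contra h
  exact absurd (Finset.le_max' _ k (Finsupp.mem_support_iff.2 h)) (not_le.2 hk)

/-- An additive map commuting with multiplication by `x` is determined on leading coefficients. -/
theorem apply_top_of_single {D K : ℕ} (f : PolyMod S →+ PolyMod S) (ψ : S →+ S)
    (hf : ∀ n s k, f (Finsupp.single n s) k = 0 ∨ k ≤ n + D)
    (hf' : ∀ n s, f (Finsupp.single n s) (n + D) = ψ s)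
    {t : PolyMod S} (ht : ∀ k, K < k → t k = 0) : f t (K + D) = ψ (t K) := by
  conv_lhs => rw [← t.sum_single]
  rw [Finsupp.sum, map_sum, Finsupp.finsetSum_apply, Finset.sum_eq_single K]
  · exact hf' _ _
  · intro n hn hne
    have hnK : n ≤ K := by
      by_contra h
      exact Finsupp.mem_support_iff.1 hn (ht n (not_le.1 h))
    rcases hf n (t n) (K + D) with h | h
    · exact h
    · omega
  · intro hK
    rw [Finsupp.notMem_support_iff.1 hK, Finsupp.single_zero, map_zero]; rfl

theorem smul_apply_top {p : R[X]} {D : ℕ} {t : PolyMod S} (ht : ∀ k, D < k → t k = 0) :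
    (p • t) (D + p.natDegree) = p.leadingCoeff • t D := by
  refine apply_top_of_single (DistribSMul.toAddMonoidHom (PolyMod S) p)
    (DistribSMul.toAddMonoidHom S p.leadingCoeff) (fun n s k => ?_) (fun n s => ?_) ht
  · rw [DistribSMul.toAddMonoidHom_apply, smul_single_apply]
    rcases le_or_gt k (n + p.natDegree) with h | h
    · exact Or.inr h
    · left
      rw [coeff_eq_zero_of_natDegree_lt (by omega), zero_smul, ite_self]
  · rw [DistribSMul.toAddMonoidHom_apply, smul_single_apply, if_pos (Nat.le_add_right _ _),
      Nat.add_sub_cancel_left]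
    rfl

theorem smul_apply_ne_zero {p : R[X]} (hp : p.Monic) {t : PolyMod S} {D : ℕ}
    (ht : HasDegree t D) : (p • t) (D + p.natDegree) ≠ 0 := by
  rw [smul_apply_top ht.2, hp.leadingCoeff, one_smul]
  exact ht.1

theorem eq_zero_of_smul_eq_zero {p : R[X]} (hp : p.Monic) {t : PolyMod S}
    (h : p • t = 0) : t = 0 := by
  by_contra ht
  obtain ⟨D, hD⟩ := exists_hasDegree ht
  exact smul_apply_ne_zero hp hD (by rw [h]; rfl)

/-- Multiplication by the monic `p ^ n` raises degrees by at least `n`, so a nonzero element of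
degree `D` is not divisible by `p ^ (D + 1)`. -/
theorem eq_zero_of_forall_pow_smul [Nontrivial R] {p : R[X]} (hp : p.Monic) (hd : 0 < p.natDegree)
    {t : PolyMod S} (h : ∀ n, ∃ u : PolyMod S, p ^ n • u = t) : t = 0 := by
  by_contra ht
  obtain ⟨D, hD⟩ := exists_hasDegree ht
  obtain ⟨u, hu⟩ := h (D + 1)
  have hu0 : u ≠ 0 := by rintro rfl; exact ht (by rw [← hu, smul_zero])
  obtain ⟨E, hE⟩ := exists_hasDegree hu0
  have h1 := smul_apply_ne_zero (hp.pow (D + 1)) hE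
  rw [hu, hp.natDegree_pow] at h1
  exact h1 (hD.2 _ (by nlinarith))

/-- Over a simple module `S`, a nonzero endomorphism of `S[x]` is injective. -/
theorem eq_zero_of_map_eq_zero [IsSimpleModule R S] (φ : PolyMod S →ₗ[R[X]] PolyMod S)
    {s₀ : S} (h : φ (Finsupp.single 0 s₀) ≠ 0) {t : PolyMod S} (ht : φ t = 0) : t = 0 := by
  have hs₀ : s₀ ≠ 0 := by
    rintro rfl
    exact h (by rw [Finsupp.single_zero, map_zero])
  obtain ⟨D, hD⟩ := exists_hasDegree h
  -- Every `s` is a multiple of `s₀`, so the degree of the image of `s₀` bounds those of all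
  -- constants.
  have hconst : ∀ s : S, ∀ k, D < k → φ (Finsupp.single 0 s) k = 0 := by
    intro s k hk
    obtain ⟨a, rfl⟩ := IsSimpleModule.toSpanSingleton_surjective R hs₀ s
    rw [LinearMap.toSpanSingleton_apply, ← C_smul_single, map_smul, C_smul_apply,
      hD.2 k hk, smul_zero]
  -- The coefficient in degree `D` is an endomorphism of the simple module `S`, nonzero at `s₀`,
  -- hence injective by Schur. So `φ` raises every degree by exactly `D`.
  let ψ : S →ₗ[R] S :=
    { toFun := fun s => φ (Finsupp.single 0 s) D
      map_add' := fun s t => by rw [Finsupp.single_add, map_add, Finsupp.add_apply]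
      map_smul' := fun a s => by rw [← C_smul_single, map_smul, C_smul_apply]; rfl }
  have hψ : Function.Injective ψ := by
    rcases LinearMap.injective_or_eq_zero ψ with h1 | h1
    · exact h1
    · exact absurd (LinearMap.congr_fun h1 s₀) hD.1
  have hX : ∀ n s, φ (Finsupp.single n s) = (X ^ n : R[X]) • φ (Finsupp.single 0 s) := by
    intro n s
    rw [← map_smul, X_pow_smul_single]
  by_contra ht0
  obtain ⟨K, hK⟩ := exists_hasDegree ht0
  refine hK.1 (hψ ?_)
  have hR : Nontrivial R := by
    by_contra h0
    rw [not_nontrivial_iff_subsingleton] at h0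
    exact hs₀ ((Module.subsingleton R S).elim _ _)
  have e := apply_top_of_single (D := D) φ.toAddMonoidHom ψ.toAddMonoidHom (fun n s k => ?_)
    (fun n s => ?_) hK.2
  · rw [map_zero]
    refine e.symm.trans ?_
    change φ t (K + D) = 0
    rw [ht]; rfl
  · change φ (Finsupp.single n s) k = 0 ∨ _
    rcases le_or_gt k (n + D) with h | h
    · exact Or.inr h
    · left
      rw [hX]
      obtain ⟨d, rfl⟩ : ∃ d, k = d + n := ⟨k - n, by omega⟩
      have := smul_apply_top (p := (X ^ n : R[X])) (D := d) (t := φ (Finsupp.single 0 s))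
        (fun k hk => hconst s k (by omega))
      rw [natDegree_X_pow] at this
      rw [this, hconst s d (by omega), smul_zero]
  · change φ (Finsupp.single n s) (n + D) = φ (Finsupp.single 0 s) D
    have := smul_apply_top (p := (X ^ n : R[X])) (hconst s)
    rw [natDegree_X_pow, (monic_X_pow n).leadingCoeff, one_smul] at this
    rw [hX, add_comm, this]

end PolyMod

end

/-! ### Denominator systems -/

open Polynomial

/-- A module `V` with a cyclic vector (up to denominators) on which a sequence of central elements
of the ring acts bijectively, and independently of each other. -/
structure DenominatorSystem (Λ : Type*) [Ring Λ] (V : Type*) [AddCommGroup V] [Module Λ V] where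
  /-- The denominators. -/
  p : ℕ → Λ
  mul_comm : ∀ i a, p i * a = a * p i
  bijective : ∀ i, Function.Bijective fun s : V => p i • s
  /-- The cyclic vector. -/
  gen : V
  gen_ne : gen ≠ 0
  exists_den : ∀ s : V, ∃ d ∈ Submonoid.closure (Set.range p), ∃ a : Λ, d • s = a • gen
  /-- The vectors whose denominators are prime to `p j`. -/
  O : ℕ → Submodule Λ V
  gen_mem : ∀ j, gen ∈ O j
  mem_of_smul_mem : ∀ i j s, i ≠ j → p i • s ∈ O j → s ∈ O j
  -- Only `O j` is free of `p j`-divisible vectors; in all of `V` every vector is divisible.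
  eq_zero_of_divisible : ∀ j s, (∀ n, ∃ t ∈ O j, p j ^ n • t = s) → s = 0
  eq_zero_of_map_eq_zero : ∀ φ : V →ₗ[Λ] V, φ gen ≠ 0 → ∀ s, φ s = 0 → s = 0

noncomputable section

/-- Iterates of `t ↦ t (t + 1)` at `X`. -/
def coprimeAux : ℕ → ℤ[X]
  | 0 => X
  | n + 1 => coprimeAux n * (coprimeAux n + 1)

/-- A sequence of pairwise comaximal monic integer polynomials of positive degree. -/
def coprimeSeq (n : ℕ) : ℤ[X] := coprimeAux n + 1

theorem coprimeAux_monic (n : ℕ) : (coprimeAux n).Monic ∧ 0 < (coprimeAux n).natDegree := by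
  induction n with
  | zero => exact ⟨monic_X, by simp [coprimeAux]⟩
  | succ n ih =>
    have h1 : (coprimeAux n + 1).Monic := ih.1.add_of_left (by
      rw [degree_one]; exact natDegree_pos_iff_degree_pos.1 ih.2)
    refine ⟨ih.1.mul h1, ?_⟩
    rw [coprimeAux, ih.1.natDegree_mul h1]
    exact Nat.add_pos_left ih.2 _

theorem coprimeSeq_monic (n : ℕ) : (coprimeSeq n).Monic :=
  (coprimeAux_monic n).1.add_of_left (by
    rw [degree_one]; exact natDegree_pos_iff_degree_pos.1 (coprimeAux_monic n).2)

theorem natDegree_coprimeSeq_pos (n : ℕ) : 0 < (coprimeSeq n).natDegree := by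
  rw [coprimeSeq, natDegree_add_eq_left_of_natDegree_lt]
  · exact (coprimeAux_monic n).2
  · rw [natDegree_one]; exact (coprimeAux_monic n).2

theorem coprimeSeq_dvd_coprimeAux {i j : ℕ} (h : i < j) : coprimeSeq i ∣ coprimeAux j := by
  induction j, h using Nat.le_induction with
  | base => exact Dvd.intro_left _ rfl
  | succ j _ ih => exact ih.trans (Dvd.intro _ rfl)

/-- As in Sylvester's sequence, the `i`-th term divides `coprimeAux j` for `i < j`, so the `j`-th
term is 1 modulo the `i`-th. -/
theorem isCoprime_coprimeSeq {i j : ℕ} (h : i ≠ j) : IsCoprime (coprimeSeq i) (coprimeSeq j) := by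
  have key : ∀ {i j : ℕ}, i < j → IsCoprime (coprimeSeq i) (coprimeSeq j) := by
    intro i j h
    obtain ⟨c, hc⟩ := coprimeSeq_dvd_coprimeAux h
    refine ⟨-c, 1, ?_⟩
    rw [coprimeSeq.eq_1 j, hc]
    ring
  rcases h.lt_or_gt with h | h
  exacts [key h, (key h).symm]

/-! ### Inverting the denominators over `R` -/

section Localization

variable (R : Type u) [Ring R]

/-- Integer polynomials as polynomials over `R`. -/
def intPoly : ℤ[X] →+* R[X] := mapRingHom (Int.castRingHom R)

variable {R}

theorem intPoly_mul_comm (q : ℤ[X]) (a : R[X]) : intPoly R q * a = a * intPoly R q := by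
  induction q using Polynomial.induction_on' with
  | add p q hp hq => rw [map_add, add_mul, mul_add, hp, hq]
  | monomial n c =>
    have : intPoly R (monomial n c) = (c : R[X]) * X ^ n := by
      rw [← C_mul_X_pow_eq_monomial]
      simp [intPoly]
    rw [this]
    exact ((Int.cast_commute c a).mul_left ((commute_X_pow a n))).eq

theorem intPoly_smul_comm {V : Type*} [AddCommGroup V] [Module R[X] V] (q : ℤ[X]) (a : R[X])
    (s : V) : intPoly R q • a • s = a • intPoly R q • s := by
  rw [← mul_smul, intPoly_mul_comm, mul_smul]

variable (R) in
/-- The submonoid of all denominators. -/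
def denominators : Submonoid R[X] := Submonoid.closure (Set.range fun n => intPoly R (coprimeSeq n))

/-- Denominators are lifted to `ℤ[X]`, where Bézout identities are available whatever `R` is;
monicity and these identities survive in `R[X]`. -/
theorem exists_intPoly_of_mem {T : Set ℕ} {d : R[X]}
    (hd : d ∈ Submonoid.closure ((fun n => intPoly R (coprimeSeq n)) '' T)) :
    ∃ q : ℤ[X], q.Monic ∧ intPoly R q = d ∧ ∀ j ∉ T, IsCoprime q (coprimeSeq j) := by
  induction hd using Submonoid.closure_induction with
  | mem x hx =>
    obtain ⟨i, hi, rfl⟩ := hx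
    exact ⟨_, coprimeSeq_monic i, rfl, fun j hj =>
      isCoprime_coprimeSeq (by rintro rfl; exact hj hi)⟩
  | one => exact ⟨1, monic_one, map_one _, fun _ _ => isCoprime_one_left⟩
  | mul x y _ _ hx hy =>
    obtain ⟨q, hq, rfl, h⟩ := hx
    obtain ⟨q', hq', rfl, h'⟩ := hy
    exact ⟨q * q', hq.mul hq', map_mul _ _ _, fun j hj => (h j hj).mul_left (h' j hj)⟩

theorem exists_intPoly_of_mem_denominators {d : R[X]} (hd : d ∈ denominators R) :
    ∃ q : ℤ[X], q.Monic ∧ intPoly R q = d := by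
  rw [denominators, ← Set.image_univ] at hd
  obtain ⟨q, h1, h2, -⟩ := exists_intPoly_of_mem hd
  exact ⟨q, h1, h2⟩

theorem denominators_mul_comm (d : denominators R) (a : R[X]) : d * a = a * d := by
  obtain ⟨q, -, hq⟩ := exists_intPoly_of_mem_denominators d.2
  rw [← hq, intPoly_mul_comm]

/-- The denominators are central, so the Ore condition is just commutation and cancellation can
reuse the same `s`. -/
instance : OreLocalization.OreSet (denominators R) where
  ore_right_cancel r₁ r₂ s h :=
    ⟨s, by rw [denominators_mul_comm, denominators_mul_comm, h]⟩
  oreNum r _ := r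
  oreDenom _ s := s
  ore_eq r s := denominators_mul_comm s r

variable (R) (S : Type u) [AddCommGroup S] [Module R S]

/-- The module `S[x]` with the denominators inverted. -/
abbrev PolyLoc : Type u := OreLocalization (denominators R) (PolyMod S)

/-- The localization map. -/
def toPolyLoc : PolyMod S →ₗ[R[X]] PolyLoc R S where
  toFun t := OreLocalization.oreDiv t 1
  map_add' s t := by rw [OreLocalization.add_oreDiv]
  map_smul' a t := (OreLocalization.smul_oreDiv_one a t).symm

variable {R S}

theorem toPolyLoc_injective : Function.Injective (toPolyLoc R S) := by
  intro s t h
  obtain ⟨u, v, h1, h2⟩ := OreLocalization.oreDiv_eq_iff.1 h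
  simp only [mul_one, OneMemClass.coe_one] at h2
  obtain ⟨q, hq, hqu⟩ := exists_intPoly_of_mem_denominators u.2
  have h3 : intPoly R q • (s - t) = 0 := by
    rw [hqu, smul_sub, sub_eq_zero, h2, ← h1, ← h2]; rfl
  exact sub_eq_zero.1 (PolyMod.eq_zero_of_smul_eq_zero (hq.map _) h3)

theorem smul_bijective_polyLoc {d : R[X]} (hd : d ∈ denominators R) :
    Function.Bijective fun s : PolyLoc R S => d • s := by
  have := MulAction.bijective (β := PolyLoc R S)
    (OreLocalization.numeratorUnit (⟨d, hd⟩ : denominators R))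
  convert this using 2 with s
  exact (OreLocalization.oreDiv_one_smul _ _).symm

theorem exists_smul_eq_toPolyLoc (s : PolyLoc R S) :
    ∃ d ∈ denominators R, ∃ t, d • s = toPolyLoc R S t := by
  refine OreLocalization.ind (fun t d => ?_) s
  refine ⟨d, d.2, t, ?_⟩
  rw [← OreLocalization.oreDiv_one_smul, OreLocalization.smul_cancel]
  rfl

theorem smul_comm_of_mem {d : R[X]} (hd : d ∈ denominators R) {V : Type*} [AddCommGroup V]
    [Module R[X] V] (a : R[X]) (s : V) : d • a • s = a • d • s := by
  rw [← mul_smul, denominators_mul_comm ⟨d, hd⟩, mul_smul]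

/-- A simple module over `R` gives rise to a denominator system over `R[x]`. -/
def denominatorSystem [Nontrivial R] [IsSimpleModule R S] (s₀ : S) (hs₀ : s₀ ≠ 0) :
    DenominatorSystem R[X] (PolyLoc R S) := by
  have hcyc : ∀ t : PolyMod S, ∃ a : R[X], t = a • Finsupp.single 0 s₀ := by
    intro t
    induction t using Finsupp.induction_linear with
    | zero => exact ⟨0, (zero_smul _ _).symm⟩
    | add s t hs ht =>
      obtain ⟨a, rfl⟩ := hs
      obtain ⟨b, rfl⟩ := ht
      exact ⟨a + b, (add_smul _ _ _).symm⟩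
    | single n s =>
      obtain ⟨a, rfl⟩ := IsSimpleModule.toSpanSingleton_surjective R hs₀ s
      exact ⟨monomial n a, by rw [PolyMod.monomial_smul_single, zero_add]; rfl⟩
  have hsub : ∀ T : Set ℕ, Submonoid.closure ((fun n => intPoly R (coprimeSeq n)) '' T) ≤
      denominators R := fun T => Submonoid.closure_mono (Set.image_subset_range _ _)
  exact
  { p := fun n => intPoly R (coprimeSeq n)
    mul_comm := fun i => intPoly_mul_comm _
    bijective := fun i => smul_bijective_polyLoc (Submonoid.subset_closure ⟨i, rfl⟩)
    gen := toPolyLoc R S (Finsupp.single 0 s₀)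
    gen_ne := fun h => hs₀ (by
      rw [← map_zero (toPolyLoc R S)] at h
      simpa using toPolyLoc_injective h)
    exists_den := fun s => by
      obtain ⟨d, hd, t, ht⟩ := exists_smul_eq_toPolyLoc s
      obtain ⟨a, rfl⟩ := hcyc t
      exact ⟨d, hd, a, by rw [ht, map_smul]⟩
    -- The elements that become polynomials after multiplication by denominators other than the
    -- `j`-th.
    O := fun j =>
      { carrier := {s | ∃ d ∈ Submonoid.closure ((fun n => intPoly R (coprimeSeq n)) '' {j}ᶜ),
          ∃ t, d • s = toPolyLoc R S t}
        add_mem' := by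
          rintro s s' ⟨d, hd, t, ht⟩ ⟨d', hd', t', ht'⟩
          refine ⟨d * d', mul_mem hd hd', d' • t + d • t', ?_⟩
          rw [map_add, map_smul, map_smul, ← ht, ← ht', smul_add, mul_smul, mul_smul,
            smul_comm_of_mem (hsub _ hd) d' s]
        zero_mem' := ⟨1, one_mem _, 0, by rw [smul_zero, map_zero]⟩
        smul_mem' := by
          rintro a s ⟨d, hd, t, ht⟩
          exact ⟨d, hd, a • t, by rw [map_smul, ← ht, smul_comm_of_mem (hsub _ hd)]⟩ }
    gen_mem := fun j => ⟨1, one_mem _, _, one_smul _ _⟩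
    mem_of_smul_mem := by
      rintro i j s hij ⟨d, hd, t, ht⟩
      exact ⟨d * intPoly R (coprimeSeq i),
        mul_mem hd (Submonoid.subset_closure ⟨i, hij, rfl⟩), t, by rw [mul_smul, ht]⟩
    eq_zero_of_divisible := by
      intro j s hs
      obtain ⟨u, ⟨d, hd, t, ht⟩, hu⟩ := hs 0
      rw [pow_zero, one_smul] at hu
      subst hu
      have ht0 : t = 0 := by
        refine PolyMod.eq_zero_of_forall_pow_smul ((coprimeSeq_monic j).map (Int.castRingHom R))
          (by rw [(coprimeSeq_monic j).natDegree_map]; exact natDegree_coprimeSeq_pos j)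
          fun n => ?_
        obtain ⟨w, ⟨e, he, r, hr⟩, hw⟩ := hs n
        obtain ⟨q, -, rfl, hq⟩ := exists_intPoly_of_mem he
        -- Here `q • t` is a multiple of the `n`-th power of the `j`-th polynomial and `q` is
        -- comaximal with that power, so `t` itself is such a multiple in `S[x]`; the degree
        -- argument then gives `t = 0`.
        obtain ⟨a, b, hab⟩ := (hq j (by simp)).pow_right (n := n)
        have h1 : intPoly R q • t = intPoly R (coprimeSeq j) ^ n • d • r := by
          apply toPolyLoc_injective (R := R)
          have h3 : ∀ w : PolyLoc R S, intPoly R q • d • intPoly R (coprimeSeq j ^ n) • w =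
              intPoly R (coprimeSeq j ^ n) • d • intPoly R q • w := fun w => by
            simp only [← mul_smul]
            congr 1
            rw [intPoly_mul_comm q, mul_assoc, ← intPoly_mul_comm q, ← mul_assoc, ← mul_assoc,
              intPoly_mul_comm (coprimeSeq j ^ n), mul_assoc, mul_assoc, intPoly_mul_comm q]
          rw [map_smul, map_smul, map_smul, ← ht, ← hr, ← hw, ← map_pow]
          exact h3 w
        refine ⟨intPoly R a • d • r + intPoly R b • t, ?_⟩
        change intPoly R (coprimeSeq j) ^ n • _ = t
        have h2 : t = intPoly R (a * q + b * coprimeSeq j ^ n) • t := by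
          rw [hab, map_one, one_smul]
        conv_rhs => rw [h2]
        rw [map_add, map_mul, map_mul, add_smul, mul_smul, mul_smul, h1, smul_add, ← map_pow,
          intPoly_smul_comm (coprimeSeq j ^ n) (intPoly R a),
          intPoly_smul_comm (coprimeSeq j ^ n) (intPoly R b)]
      rw [ht0, map_zero] at ht
      exact (smul_bijective_polyLoc (hsub _ hd)).1 (by simpa using ht)
    eq_zero_of_map_eq_zero := by
      intro φ hφ s hs
      -- Since `S[x]` is cyclic, one `d` clears the denominators of `φ` on all of `S[x]`. This
      -- reduces to an endomorphism `χ` of `S[x]`.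
      obtain ⟨d, hd, t₀, ht₀⟩ := exists_smul_eq_toPolyLoc (φ (toPolyLoc R S (Finsupp.single 0 s₀)))
      have hcomm : ∀ (a : R[X]) (v : PolyLoc R S), d • a • v = a • d • v :=
        fun a v => smul_comm_of_mem hd a v
      have hmul : ∀ (t : PolyMod S) (a : R[X]), t = a • Finsupp.single 0 s₀ →
          d • φ (toPolyLoc R S t) = toPolyLoc R S (a • t₀) := by
        rintro t a rfl
        rw [map_smul, map_smul, map_smul, ← ht₀]
        exact hcomm _ _
      let ψ : PolyMod S →ₗ[R[X]] PolyLoc R S :=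
        { toFun := fun t => d • φ (toPolyLoc R S t)
          map_add' := fun s t => by rw [map_add, map_add, smul_add]
          map_smul' := fun a t => by
            rw [map_smul, map_smul]; exact hcomm _ _ }
      have hψ : ∀ t, ψ t ∈ LinearMap.range (toPolyLoc R S) := fun t => by
        obtain ⟨a, ha⟩ := hcyc t
        exact ⟨_, (hmul t a ha).symm⟩
      let χ : PolyMod S →ₗ[R[X]] PolyMod S :=
        (LinearEquiv.ofInjective _ (toPolyLoc_injective (R := R) (S := S))).symm.toLinearMap ∘ₗ
          ψ.codRestrict _ hψ
      have hχ : ∀ t, toPolyLoc R S (χ t) = d • φ (toPolyLoc R S t) := fun t => by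
        have := congrArg Subtype.val ((LinearEquiv.ofInjective _
          (toPolyLoc_injective (R := R) (S := S))).apply_symm_apply (ψ.codRestrict _ hψ t))
        exact this
      obtain ⟨e, he, t, ht⟩ := exists_smul_eq_toPolyLoc s
      have ht0 : t = 0 := by
        refine PolyMod.eq_zero_of_map_eq_zero χ (s₀ := s₀) (fun h => hφ ?_) ?_
        · have h1 := hχ (Finsupp.single 0 s₀)
          rw [h, map_zero] at h1
          exact (smul_bijective_polyLoc hd).1 (by simpa using h1.symm)
        · apply toPolyLoc_injective (R := R)
          rw [hχ, ← ht, map_smul, hs, smul_zero, smul_zero, map_zero]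
      rw [ht0, map_zero] at ht
      exact (smul_bijective_polyLoc he).1 (by simpa using ht) }

end Localization

theorem countable_polynomial (R : Type*) [Semiring R] [Countable R] : Countable R[X] :=
  Function.Injective.countable
    (f := fun p : R[X] => Finsupp.ofSupportFinite p.coeff (p.support.finite_toSet.subset
      fun _ hn => Polynomial.mem_support_iff.2 hn)) fun _ _ h =>
    Polynomial.ext fun n => DFunLike.congr_fun h n

/-- Over a countable nonzero ring, there is a countable denominator system. -/
theorem exists_denominatorSystem (R : Type u) [Ring R] [Countable R] [Nontrivial R] :
    ∃ (V : Type u) (_ : AddCommGroup V) (_ : Module R[X] V),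
      Countable V ∧ Nonempty (DenominatorSystem R[X] V) := by
  -- A maximal left ideal, so that the quotient is a simple left module.
  obtain ⟨m, hm⟩ := Ideal.exists_maximal R
  have : IsSimpleModule R (R ⧸ m) := isSimpleModule_iff_isCoatom.2 hm.out
  have := IsSimpleModule.nontrivial R (R ⧸ m)
  obtain ⟨s₀, hs₀⟩ := exists_ne (0 : R ⧸ m)
  have : Countable (R ⧸ m) := Quotient.countable
  have := countable_polynomial R
  have : Countable (PolyLoc R (R ⧸ m)) := inferInstanceAs (Countable (Quotient _))
  exact ⟨_, inferInstance, inferInstance, this, ⟨denominatorSystem s₀ hs₀⟩⟩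

end

noncomputable section

/-! ### Extending isomorphisms to modules of fractions -/

section Extension

variable {Λ W W' : Type*} [Ring Λ] [AddCommGroup W] [Module Λ W] [AddCommGroup W'] [Module Λ W']

/-- A linear map defined on a submodule extends to the module of fractions. -/
theorem exists_extension {M : Submonoid Λ} (hc : ∀ d ∈ M, ∀ a : Λ, d * a = a * d)
    (hb : ∀ d ∈ M, Function.Bijective fun w : W' => d • w) {G : Submodule Λ W}
    (hG : ∀ w, ∃ d ∈ M, d • w ∈ G) (f : G →ₗ[Λ] W') :
    ∃ F : W →ₗ[Λ] W', ∀ g : G, F g = f g := by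
  choose d hd hdG using hG
  choose F hF using fun w => (hb (d w) (hd w)).2 (f ⟨d w • w, hdG w⟩)
  -- `F w` is `f (d w • w)` divided by the chosen `d w`; any other admissible denominator gives the
  -- same value, whence linearity.
  have key : ∀ (w : W) (e : Λ) (he : e ∈ M) (h : e • w ∈ G), e • F w = f ⟨e • w, h⟩ := by
    intro w e he h
    apply (hb (d w) (hd w)).1
    have h1 : d w • e • F w = e • d w • F w := by rw [← mul_smul, ← hc e he, mul_smul]
    change d w • e • F w = d w • f _
    rw [h1, ← map_smul]
    have h2 := hF w
    change d w • F w = _ at h2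
    rw [h2, ← map_smul]
    congr 1
    apply Subtype.ext
    change e • d w • w = d w • e • w
    rw [← mul_smul, hc e he, mul_smul]
  have huniq : ∀ (w : W) (e : Λ) (_ : e ∈ M) (h : e • w ∈ G) (x : W'),
      e • x = f ⟨e • w, h⟩ → F w = x := fun w e he h x hx =>
    (hb e he).1 ((key w e he h).trans hx.symm)
  refine ⟨{ toFun := F, map_add' := fun w w' => ?_, map_smul' := fun a w => ?_ }, fun g => ?_⟩
  · have h1 : (d w * d w') • w ∈ G := by
      rw [hc _ (hd w), mul_smul]; exact G.smul_mem _ (hdG w)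
    have h2 : (d w * d w') • w' ∈ G := by rw [mul_smul]; exact G.smul_mem _ (hdG w')
    have h3 : d w * d w' ∈ M := mul_mem (hd w) (hd w')
    refine huniq _ _ h3 (by rw [smul_add]; exact add_mem h1 h2) _ ?_
    rw [smul_add, key w _ h3 h1, key w' _ h3 h2, ← map_add]
    congr 1
    exact Subtype.ext (smul_add _ _ _).symm
  · have h0 : d w • a • w = a • d w • w := by rw [← mul_smul, hc _ (hd w), mul_smul]
    refine huniq _ _ (hd w) (by rw [h0]; exact G.smul_mem _ (hdG w)) _ ?_
    have h1 : d w • a • F w = a • d w • F w := by rw [← mul_smul, hc _ (hd w), mul_smul]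
    rw [RingHom.id_apply, h1, key w _ (hd w) (hdG w), ← map_smul]
    congr 1
    exact Subtype.ext h0.symm
  · refine huniq _ 1 (one_mem _) (by rw [one_smul]; exact g.2) _ ?_
    rw [one_smul]
    congr 1
    exact Subtype.ext (one_smul _ _).symm

/-- An isomorphism between submodules extends to the module of fractions. -/
theorem exists_linearEquiv_extension {M : Submonoid Λ} (hc : ∀ d ∈ M, ∀ a : Λ, d * a = a * d)
    (hb : ∀ d ∈ M, Function.Bijective fun w : W => d • w) {G G' : Submodule Λ W}
    (hG : ∀ w, ∃ d ∈ M, d • w ∈ G) (hG' : ∀ w, ∃ d ∈ M, d • w ∈ G') (f : G ≃ₗ[Λ] G') :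
    ∃ F : W ≃ₗ[Λ] W, ∀ w, F w ∈ G' ↔ w ∈ G := by
  obtain ⟨F, hF⟩ := exists_extension hc hb hG (G'.subtype ∘ₗ f.toLinearMap)
  obtain ⟨F', hF'⟩ := exists_extension hc hb hG' (G.subtype ∘ₗ f.symm.toLinearMap)
  have h1 : ∀ g : G, F g = f g := hF
  have h2 : ∀ g : G', F' g = f.symm g := hF'
  have h3 : ∀ w, F' (F w) = w := fun w => by
    obtain ⟨d, hd, hdw⟩ := hG w
    apply (hb d hd).1
    change d • F' (F w) = d • w
    rw [← map_smul, ← map_smul, h1 ⟨_, hdw⟩, h2, f.symm_apply_apply]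
  have h4 : ∀ w, F (F' w) = w := fun w => by
    obtain ⟨d, hd, hdw⟩ := hG' w
    apply (hb d hd).1
    change d • F (F' w) = d • w
    rw [← map_smul, ← map_smul, h2 ⟨_, hdw⟩, h1, f.apply_symm_apply]
  refine ⟨LinearEquiv.ofLinearMap F F' (LinearMap.ext h4) (LinearMap.ext h3), fun w => ⟨?_, ?_⟩⟩
  · intro h
    change F w ∈ G' at h
    rw [← h3 w, h2 ⟨_, h⟩]
    exact Subtype.prop _
  · intro h
    change F w ∈ G'
    rw [h1 ⟨_, h⟩]
    exact Subtype.prop _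

end Extension

/-! ### Recovering kernels of idempotents from divisibility -/

section Tags

variable {Λ V : Type*} [Ring Λ] [AddCommGroup V] [Module Λ V] {I J : Type*}

variable (Λ V) in
/-- The linear map of `I →₀ V` induced by a partial map of the indices. -/
def tagMap (r : I → Option I) : (I →₀ V) →ₗ[Λ] (I →₀ V) :=
  Finsupp.lsum ℕ fun b => (r b).elim 0 Finsupp.lsingle

theorem tagMap_single_of_none {r : I → Option I} {b : I} (h : r b = none) (s : V) :
    tagMap Λ V r (Finsupp.single b s) = 0 := by
  simp [tagMap, h]

theorem tagMap_single_of_some {r : I → Option I} {b b' : I} (h : r b = some b') (s : V) :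
    tagMap Λ V r (Finsupp.single b s) = Finsupp.single b' s := by
  simp [tagMap, h]

/-- A partial map of the indices is a tag if it is idempotent. -/
def IsTag (r : I → Option I) : Prop := ∀ b b', r b = some b' → r b' = some b'

theorem IsTag.tagMap_tagMap {r : I → Option I} (hr : IsTag r) (w : I →₀ V) :
    tagMap Λ V r (tagMap Λ V r w) = tagMap Λ V r w := by
  induction w using Finsupp.induction_linear with
  | zero => simp
  | add f g hf hg => simp only [map_add, hf, hg]
  | single b s =>
    cases h : r b with
    | none => rw [tagMap_single_of_none h, map_zero]
    | some b' => rw [tagMap_single_of_some h, tagMap_single_of_some (hr b b' h)]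

theorem tagMap_domLCongr {r r' : I → Option I} (e : I ≃ I) (h : ∀ b, r' (e b) = (r b).map e)
    (w : I →₀ V) : tagMap Λ V r' (Finsupp.domLCongr (R := Λ) e w) =
      Finsupp.domLCongr (R := Λ) e (tagMap Λ V r w) := by
  induction w using Finsupp.induction_linear with
  | zero => simp
  | add f g hf hg => simp only [map_add, hf, hg]
  | single b s =>
    rw [Finsupp.domLCongr_single]
    cases hb : r b with
    | none =>
      rw [tagMap_single_of_none hb, tagMap_single_of_none (by rw [h, hb]; rfl), map_zero]
    | some b' =>
      rw [tagMap_single_of_some hb, tagMap_single_of_some (b' := e b') (by rw [h, hb]; rfl),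
        Finsupp.domLCongr_single]

variable (D : DenominatorSystem Λ V)

namespace DenominatorSystem

/-- Products of denominators. -/
def dens : Submonoid Λ := Submonoid.closure (Set.range D.p)

theorem p_mem (i : ℕ) : D.p i ∈ D.dens := Submonoid.subset_closure ⟨i, rfl⟩

theorem dens_mul_comm {d : Λ} (hd : d ∈ D.dens) (a : Λ) : d * a = a * d := by
  induction hd using Submonoid.closure_induction with
  | mem x hx => obtain ⟨i, rfl⟩ := hx; exact D.mul_comm i a
  | one => rw [one_mul, mul_one]
  | mul x y _ _ hx hy => rw [mul_assoc, hy, ← mul_assoc, hx, mul_assoc]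

theorem dens_smul_comm {W : Type*} [AddCommGroup W] [Module Λ W] {d : Λ} (hd : d ∈ D.dens) (a : Λ)
    (w : W) : d • a • w = a • d • w := by
  rw [← mul_smul, D.dens_mul_comm hd, mul_smul]

theorem dens_bijective {d : Λ} (hd : d ∈ D.dens) : Function.Bijective fun s : V => d • s := by
  induction hd using Submonoid.closure_induction with
  | mem x hx => obtain ⟨i, rfl⟩ := hx; exact D.bijective i
  | one => simp only [one_smul]; exact Function.bijective_id
  | mul x y _ _ hx hy => simp only [mul_smul]; exact hx.comp hy

theorem dens_bijective_finsupp {d : Λ} (hd : d ∈ D.dens) :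
    Function.Bijective fun w : I →₀ V => d • w := by
  refine ⟨fun w w' h => Finsupp.ext fun i => (D.dens_bijective hd).1 (DFunLike.congr_fun h i),
    fun w => ?_⟩
  induction w using Finsupp.induction_linear with
  | zero => exact ⟨0, smul_zero _⟩
  | add f g hf hg =>
    obtain ⟨f, rfl⟩ := hf
    obtain ⟨g, rfl⟩ := hg
    exact ⟨f + g, smul_add _ _ _⟩
  | single b s =>
    obtain ⟨s, rfl⟩ := (D.dens_bijective hd).2 s
    exact ⟨Finsupp.single b s, Finsupp.smul_single _ _ _⟩

/-- The submodule of `I →₀ V` in which the elements of the kernels of the tags are made divisible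
by the corresponding denominators. -/
def tagModule (k : J → ℕ) (r : J → I → Option I) : Submodule Λ (I →₀ V) :=
  Submodule.span Λ (Set.range (fun b => Finsupp.single b D.gen) ∪
    {w | ∃ (j : J) (m : ℕ) (b : I), D.p (k j) ^ m • w =
      Finsupp.single b D.gen - tagMap Λ V (r j) (Finsupp.single b D.gen)})

/-- The elements of the tag module divisible in it by all powers of the `j`-th denominator. -/
def divisiblePart (k : J → ℕ) (r : J → I → Option I) (j : J) : Submodule Λ (I →₀ V) where
  carrier := {g | ∀ n, ∃ h ∈ D.tagModule k r, D.p (k j) ^ n • h = g}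
  add_mem' := fun {g g'} hg hg' n => by
    obtain ⟨h, hh, e⟩ := hg n
    obtain ⟨h', hh', e'⟩ := hg' n
    exact ⟨h + h', add_mem hh hh', by rw [smul_add, e, e']⟩
  zero_mem' := fun _ => ⟨0, zero_mem _, smul_zero _⟩
  smul_mem' := fun a g hg n => by
    obtain ⟨h, hh, e⟩ := hg n
    exact ⟨a • h, Submodule.smul_mem _ _ hh, by
      rw [D.dens_smul_comm (pow_mem (D.p_mem _) _), e]⟩

variable {D} {k : J → ℕ} {r : J → I → Option I}

theorem single_gen_mem (b : I) : Finsupp.single b D.gen ∈ D.tagModule k r :=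
  Submodule.subset_span (Or.inl ⟨b, rfl⟩)

theorem sub_tagMap_mem (j : J) (b : I) :
    Finsupp.single b D.gen - tagMap Λ V (r j) (Finsupp.single b D.gen) ∈
      D.divisiblePart k r j := fun n => by
  obtain ⟨w, hw⟩ := (D.dens_bijective_finsupp (I := I) (pow_mem (D.p_mem (k j)) n)).2
    (Finsupp.single b D.gen - tagMap Λ V (r j) (Finsupp.single b D.gen))
  exact ⟨w, Submodule.subset_span (Or.inr ⟨j, n, b, hw⟩), hw⟩

theorem tagMap_single_gen_apply_mem (q : I → Option I) (b c : I) (j : ℕ) :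
    tagMap Λ V q (Finsupp.single b D.gen) c ∈ D.O j := by
  cases h : q b with
  | none => rw [tagMap_single_of_none h]; exact zero_mem _
  | some b' =>
    classical
    rw [tagMap_single_of_some h, Finsupp.single_apply]
    split_ifs
    exacts [D.gen_mem j, zero_mem _]

theorem mem_O_of_pow_smul_mem {i j : ℕ} (hij : i ≠ j) (n : ℕ) {s : V} (h : D.p i ^ n • s ∈ D.O j) :
    s ∈ D.O j := by
  induction n with
  | zero => simpa using h
  | succ n ih =>
    rw [pow_succ', mul_smul] at h
    exact ih (D.mem_of_smul_mem i j _ hij h)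

/-- The generators divided by powers of `p (k j)` are killed by the idempotent `r j`; the others
only involve denominators different from `p (k j)`, as `k` is injective. -/
theorem tagMap_apply_mem (hk : Function.Injective k) (hr : ∀ j, IsTag (r j)) (j : J) {g : I →₀ V}
    (hg : g ∈ D.tagModule k r) (c : I) : tagMap Λ V (r j) g c ∈ D.O (k j) := by
  induction hg using Submodule.span_induction generalizing c with
  | mem w hw =>
    rcases hw with ⟨b, rfl⟩ | ⟨i, m, b, hw⟩
    · exact tagMap_single_gen_apply_mem _ _ _ _
    · have h1 := congrArg (tagMap Λ V (r j)) hw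
      rw [map_smul, map_sub] at h1
      by_cases hij : i = j
      · subst hij
        rw [(hr i).tagMap_tagMap, sub_self] at h1
        have h2 : tagMap Λ V (r i) w = 0 :=
          (D.dens_bijective_finsupp (pow_mem (D.p_mem (k i)) m)).1 (by simpa using h1)
        rw [h2]
        exact zero_mem _
      · refine mem_O_of_pow_smul_mem (fun h => hij (hk h)) m ?_
        rw [← Finsupp.smul_apply, h1, Finsupp.sub_apply]
        refine sub_mem (tagMap_single_gen_apply_mem _ _ _ _) ?_
        cases h : r i b with
        | none => rw [tagMap_single_of_none h, map_zero]; exact zero_mem _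
        | some b' =>
          rw [tagMap_single_of_some h]
          exact tagMap_single_gen_apply_mem _ _ _ _
  | zero => rw [map_zero]; exact zero_mem _
  | add w w' _ _ hw hw' => rw [map_add]; exact add_mem (hw c) (hw' c)
  | smul a w _ hw => rw [map_smul]; exact Submodule.smul_mem _ _ (hw c)

/-- The coordinates of the image under `r j` are divisible by all powers of `p (k j)` inside `O (k
j)`, hence vanish. -/
theorem tagMap_eq_zero_of_mem (hk : Function.Injective k) (hr : ∀ j, IsTag (r j)) {j : J}
    {g : I →₀ V} (hg : g ∈ D.divisiblePart k r j) : tagMap Λ V (r j) g = 0 := by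
  refine Finsupp.ext fun c => D.eq_zero_of_divisible (k j) _ fun n => ?_
  obtain ⟨h, hh, e⟩ := hg n
  exact ⟨_, tagMap_apply_mem hk hr j hh c, by rw [← e, map_smul]; rfl⟩

/-- Converse to `tagMap_eq_zero_of_mem`: if `r j` kills `w`, a multiple of `w` by a denominator lies
in the divisible part. Together they describe the kernel of `r j` inside the module structure. -/
theorem exists_smul_mem_of_tag (w : I →₀ V) (j : J) : ∃ d ∈ D.dens, d • w ∈ D.tagModule k r ∧
    d • w - tagMap Λ V (r j) (d • w) ∈ D.divisiblePart k r j := by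
  induction w using Finsupp.induction_linear with
  | zero =>
    refine ⟨1, one_mem _, ?_⟩
    rw [smul_zero, map_zero, sub_zero]
    exact ⟨zero_mem _, zero_mem _⟩
  | add f g hf hg =>
    obtain ⟨d, hd, h1, h2⟩ := hf
    obtain ⟨e, he, h3, h4⟩ := hg
    have h5 : (d * e) • (f + g) = e • d • f + d • e • g := by
      rw [smul_add, mul_smul, mul_smul, D.dens_smul_comm hd e f]
    refine ⟨d * e, mul_mem hd he, ?_⟩
    rw [h5]
    refine ⟨add_mem (Submodule.smul_mem _ _ h1) (Submodule.smul_mem _ _ h3), ?_⟩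
    rw [map_add, map_smul, map_smul _ d (e • g), add_sub_add_comm, ← smul_sub, ← smul_sub]
    exact add_mem (Submodule.smul_mem _ _ h2) (Submodule.smul_mem _ _ h4)
  | single b s =>
    obtain ⟨d, hd, a, e⟩ := D.exists_den s
    refine ⟨d, hd, ?_⟩
    rw [Finsupp.smul_single, e, ← Finsupp.smul_single, map_smul, ← smul_sub]
    exact ⟨Submodule.smul_mem _ _ (single_gen_mem b),
      Submodule.smul_mem _ _ (sub_tagMap_mem j b)⟩

theorem exists_smul_mem [Nonempty J] (w : I →₀ V) : ∃ d ∈ D.dens, d • w ∈ D.tagModule k r := by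
  obtain ⟨j⟩ := ‹Nonempty J›
  obtain ⟨d, hd, h, -⟩ := D.exists_smul_mem_of_tag w j
  exact ⟨d, hd, h⟩

theorem tagMap_eq_zero_of_linearEquiv (hk : Function.Injective k) {r r' : J → I → Option I}
    (hr' : ∀ j, IsTag (r' j)) {σ : (I →₀ V) ≃ₗ[Λ] (I →₀ V)}
    (hσ : ∀ w, σ w ∈ D.tagModule k r' ↔ w ∈ D.tagModule k r) {j : J} {w : I →₀ V}
    (hw : tagMap Λ V (r j) w = 0) : tagMap Λ V (r' j) (σ w) = 0 := by
  obtain ⟨d, hd, -, h⟩ := D.exists_smul_mem_of_tag (k := k) (r := r) w j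
  rw [map_smul, hw, smul_zero, sub_zero] at h
  apply (D.dens_bijective_finsupp hd).1
  change d • _ = d • _
  rw [smul_zero, ← map_smul, ← map_smul]
  refine tagMap_eq_zero_of_mem (D := D) hk hr' fun n => ?_
  obtain ⟨g, hg, e⟩ := h n
  exact ⟨σ g, (hσ g).2 hg, by rw [← map_smul, e]⟩

/-- An isomorphism of tag modules induces an automorphism of `I →₀ V` compatible with the kernels
of the tags. -/
theorem exists_linearEquiv_of_tagModule [Nonempty J] (hk : Function.Injective k)
    {r r' : J → I → Option I} (hr : ∀ j, IsTag (r j)) (hr' : ∀ j, IsTag (r' j))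
    (f : D.tagModule k r ≃ₗ[Λ] D.tagModule k r') :
    ∃ σ : (I →₀ V) ≃ₗ[Λ] (I →₀ V),
      ∀ j w, tagMap Λ V (r' j) (σ w) = 0 ↔ tagMap Λ V (r j) w = 0 := by
  obtain ⟨σ, hσ⟩ := exists_linearEquiv_extension (M := D.dens) (fun d hd => D.dens_mul_comm hd)
    (fun d hd => D.dens_bijective_finsupp hd) exists_smul_mem exists_smul_mem f
  refine ⟨σ, fun j w => ⟨fun h => ?_, tagMap_eq_zero_of_linearEquiv hk hr' hσ⟩⟩
  have := tagMap_eq_zero_of_linearEquiv (σ := σ.symm) hk hr (fun w => by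
    rw [← hσ, σ.apply_symm_apply]) h
  rwa [σ.symm_apply_apply] at this

theorem domLCongr_mem_tagModule {r r' : J → I → Option I} (e : I ≃ I)
    (h : ∀ j b, r' j (e b) = (r j b).map e) {w : I →₀ V} (hw : w ∈ D.tagModule k r) :
    Finsupp.domLCongr (R := Λ) e w ∈ D.tagModule k r' := by
  induction hw using Submodule.span_induction with
  | mem w hw =>
    rcases hw with ⟨b, rfl⟩ | ⟨j, m, b, hw⟩
    · rw [Finsupp.domLCongr_single]
      exact single_gen_mem _
    · refine Submodule.subset_span (Or.inr ⟨j, m, e b, ?_⟩)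
      rw [← map_smul, hw, map_sub, ← tagMap_domLCongr e (h j), Finsupp.domLCongr_single]
  | zero => rw [map_zero]; exact zero_mem _
  | add w w' _ _ hw hw' => rw [map_add]; exact add_mem hw hw'
  | smul a w _ hw => rw [map_smul]; exact Submodule.smul_mem _ _ hw

/-- A bijection of the indices compatible with the tags induces an isomorphism of tag modules. -/
theorem nonempty_tagModule_equiv {r r' : J → I → Option I} (e : I ≃ I)
    (h : ∀ j b, r' j (e b) = (r j b).map e) :
    Nonempty (D.tagModule k r ≃ₗ[Λ] D.tagModule k r') := by
  have h' : ∀ j b, r j (e.symm b) = (r' j b).map e.symm := fun j b => by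
    obtain ⟨b, rfl⟩ := e.surjective b
    rw [h, e.symm_apply_apply, Option.map_map, Equiv.symm_comp_self, Option.map_id, id]
  refine ⟨(Finsupp.domLCongr (R := Λ) e).ofSubmodules _ _ (le_antisymm ?_ fun w hw => ?_)⟩
  · rintro _ ⟨w, hw, rfl⟩
    exact domLCongr_mem_tagModule e h hw
  · refine ⟨Finsupp.domLCongr (R := Λ) e.symm w, domLCongr_mem_tagModule e.symm h' hw, ?_⟩
    exact (Finsupp.domLCongr (R := Λ) (M := V) e).apply_symm_apply w

end DenominatorSystem

end Tags

end

open Filter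

noncomputable section

/-! ### Trivial units in group rings over `End V` -/

section Units

variable {Λ V : Type*} [Ring Λ] [AddCommGroup V] [Module Λ V]

/-- Up to denominators `gen` generates `V`. With `eq_zero_of_map_eq_zero`, this makes each
endomorphism of `V` either zero or injective. -/
theorem DenominatorSystem.map_eq_zero_of_map_gen_eq_zero (D : DenominatorSystem Λ V)
    {φ : V →ₗ[Λ] V} (h : φ D.gen = 0) (s : V) : φ s = 0 := by
  obtain ⟨d, hd, a, e⟩ := D.exists_den s
  apply (D.dens_bijective hd).1
  change d • φ s = d • (0 : V)
  rw [← map_smul, e, map_smul, h, smul_zero, smul_zero]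

/-- Invertible equivariant maps of `Γ →₀ V` are given by trivial units if `Γ` has two unique
products. -/
theorem exists_single_of_equivariant (D : DenominatorSystem Λ V) {Γ : Type*} [Group Γ] [TwoUniqueProds Γ]
    {α α' : (Γ →₀ V) →ₗ[Λ] (Γ →₀ V)} (hinv : ∀ v, α' (α v) = v)
    (hα' : ∀ γ v, α' (Finsupp.mapDomain (· * γ) v) = Finsupp.mapDomain (· * γ) (α' v)) :
    ∃ δ, ∀ s, ∃ s', α (Finsupp.single 1 s) = Finsupp.single δ s' := by
  classical
  -- `u β γ` is the coefficient of `β` at `γ` in the group ring over `End V`; it vanishes as soon as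
  -- it kills `gen`, so the supports at `gen` control everything.
  let u (β : (Γ →₀ V) →ₗ[Λ] (Γ →₀ V)) (γ : Γ) : V →ₗ[Λ] V :=
    Finsupp.lapply γ ∘ₗ β ∘ₗ Finsupp.lsingle 1
  have hu : ∀ β γ s, u β γ s = β (Finsupp.single 1 s) γ := fun _ _ _ => rfl
  have hsupp : ∀ (β : (Γ →₀ V) →ₗ[Λ] (Γ →₀ V)) (s : V) (γ : Γ),
      γ ∉ (β (Finsupp.single 1 D.gen)).support → β (Finsupp.single 1 s) γ = 0 :=
    fun β s γ h => D.map_eq_zero_of_map_gen_eq_zero (φ := u β γ) (Finsupp.notMem_support_iff.1 h) s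
  set A := (α (Finsupp.single 1 D.gen)).support with hA
  set B := (α' (Finsupp.single 1 D.gen)).support with hB
  have hconv : ∀ h : Γ, (Finsupp.single 1 D.gen : Γ →₀ V) h =
      ∑ δ ∈ A, α' (Finsupp.single 1 (α (Finsupp.single 1 D.gen) δ)) (h * δ⁻¹) := by
    intro h
    conv_lhs => rw [← hinv (Finsupp.single 1 D.gen),
      ← Finsupp.sum_single (α (Finsupp.single 1 D.gen))]
    rw [Finsupp.sum, map_sum, Finsupp.finsetSum_apply]
    refine Finset.sum_congr rfl fun δ _ => ?_
    have h1 : Finsupp.single δ (α (Finsupp.single 1 D.gen) δ) =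
        Finsupp.mapDomain (· * δ) (Finsupp.single 1 (α (Finsupp.single 1 D.gen) δ)) := by
      rw [Finsupp.mapDomain_single, one_mul]
    rw [h1, hα']
    have h2 : ∀ w : Γ →₀ V, Finsupp.mapDomain (· * δ) w h = w (h * δ⁻¹) := fun w => by
      conv_lhs => rw [← inv_mul_cancel_right h δ]
      exact Finsupp.mapDomain_apply (mul_left_injective δ) _ _
    exact h2 _
  have hne : A.Nonempty ∧ B.Nonempty := by
    constructor <;> rw [Finset.nonempty_iff_ne_empty] <;> intro h0 <;> have h1 := hconv 1
    · rw [h0, Finset.sum_empty, Finsupp.single_eq_same] at h1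
      exact D.gen_ne h1
    · rw [Finsupp.single_eq_same, Finset.sum_eq_zero] at h1
      · exact D.gen_ne h1
      · exact fun δ _ => hsupp α' _ _ (by rw [← hB, h0]; exact Finset.notMem_empty _)
  -- At a unique product only one term of the convolution survives, and it is nonzero because the
  -- coefficient of `α'` is injective; but the sum is supported at 1.
  have hone : ∀ p : Γ × Γ, p ∈ B ×ˢ A → UniqueMul B A p.1 p.2 → p.1 * p.2 = 1 := by
    rintro ⟨ε, δ⟩ hp hun
    rw [Finset.mem_product] at hp
    by_contra h
    have h1 := hconv (ε * δ)
    rw [Finsupp.single_eq_of_ne h, Finset.sum_eq_single_of_mem δ hp.2 fun δ' hδ' hne => ?_,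
      mul_inv_cancel_right] at h1
    · exact Finsupp.mem_support_iff.1 hp.2
        (D.eq_zero_of_map_eq_zero (u α' ε) (Finsupp.mem_support_iff.1 hp.1) _ h1.symm)
    · exact hsupp α' _ _ fun hmem => hne (hun hmem hδ' (inv_mul_cancel_right _ _)).2
  -- Otherwise there are two distinct unique products, both equal to 1, which contradicts
  -- uniqueness.
  have hcard : B.card * A.card ≤ 1 := by
    by_contra h
    obtain ⟨p, hp, q, hq, hpq, hup, huq⟩ :=
      TwoUniqueProds.uniqueMul_of_one_lt_card (not_le.1 h)
    have h1 := hone p hp hup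
    have h2 := hone q hq huq
    rw [Finset.mem_product] at hp
    have := huq hp.1 hp.2 (h1.trans h2.symm)
    exact hpq (Prod.ext this.1 this.2)
  have hA1 : A.card = 1 := by
    have h1 := hne.1.card_pos
    have h2 := hne.2.card_pos
    nlinarith
  obtain ⟨δ, hδ⟩ := Finset.card_eq_one.1 hA1
  refine ⟨δ, fun s => ⟨_, Finsupp.support_subset_singleton.1 fun γ hγ => ?_⟩⟩
  by_contra h
  exact Finsupp.mem_support_iff.1 hγ (hsupp α s γ (by rw [← hA, hδ]; exact h))

end Units

/-! ### Coding colours on a `Γ`-set -/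

/-- Eventually constant sequences. -/
@[ext]
structure EvConst (X : Type*) where
  /-- The underlying sequence. -/
  val : ℕ → X
  exists_eventually_eq : ∃ x, ∀ᶠ n in atTop, val n = x

namespace EvConst

variable {X : Type*}

/-- The eventual value. -/
def lim (z : EvConst X) : X := z.2.choose

theorem eventually_eq_lim (z : EvConst X) : ∀ᶠ n in atTop, z.1 n = z.lim := z.2.choose_spec

theorem lim_eq {z : EvConst X} {x : X} (h : ∀ᶠ n in atTop, z.1 n = x) : z.lim = x := by
  obtain ⟨n, h1, h2⟩ := (z.eventually_eq_lim.and h).exists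
  exact h1.symm.trans h2

/-- Constant sequences. -/
def const (x : X) : EvConst X := ⟨fun _ => x, x, Eventually.of_forall fun _ => rfl⟩

theorem lim_const (x : X) : (const x).lim = x := lim_eq (Eventually.of_forall fun _ => rfl)

instance [Countable X] : Countable (EvConst X) := by
  refine Function.Surjective.countable (α := List X × X) (f := fun p =>
    ⟨fun n => p.1.getD n p.2, p.2, eventually_atTop.2 ⟨p.1.length, fun n hn =>
      List.getD_eq_default _ _ hn⟩⟩) fun z => ?_
  obtain ⟨N, hN⟩ := eventually_atTop.1 z.eventually_eq_lim
  refine ⟨(List.ofFn fun i : Fin N => z.1 i, z.lim), EvConst.ext (funext fun n => ?_)⟩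
  change List.getD _ _ _ = _
  by_cases h : n < N
  · rw [List.getD_eq_getElem _ _ (by simpa using h), List.getElem_ofFn]
  · rw [List.getD_eq_default _ _ (by simpa using h), hN n (not_lt.1 h)]

end EvConst

/-- The basis elements of the coding modules: for each `n`, a copy of the group `Γ` and a copy of
the `Γ`-set `Γ ⊕ X`, and the eventually constant sequences in `X`. -/
inductive CodeIndex (Γ X : Type*)
  | grp (n : ℕ) (γ : Γ)
  | act (n : ℕ) (y : Γ ⊕ X)
  | seq (z : EvConst X)

/-- The tags of the coding modules. -/
inductive CodeTag (Γ X K : Type*)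
  | sortGrp (n : ℕ)
  | sortAct (n : ℕ)
  | sortSeq
  | colour (c : K)
  | graph (n : ℕ) (y : Γ ⊕ X)
  | eval (n : ℕ)

section Code

variable {Γ X K : Type*}

instance [Countable Γ] [Countable X] : Countable (CodeIndex Γ X) :=
  Function.Surjective.countable (α := (ℕ × Γ) ⊕ (ℕ × (Γ ⊕ X)) ⊕ EvConst X)
    (f := Sum.elim (fun p => .grp p.1 p.2) (Sum.elim (fun p => .act p.1 p.2) .seq)) (by
      rintro (⟨n, γ⟩ | ⟨n, y⟩ | z)
      exacts [⟨.inl (n, γ), rfl⟩, ⟨.inr (.inl (n, y)), rfl⟩, ⟨.inr (.inr z), rfl⟩])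

instance [Countable Γ] [Countable X] [Countable K] : Countable (CodeTag Γ X K) :=
  Function.Surjective.countable (α := ℕ ⊕ ℕ ⊕ Unit ⊕ K ⊕ (ℕ × (Γ ⊕ X)) ⊕ ℕ)
    (f := Sum.elim .sortGrp (Sum.elim .sortAct (Sum.elim (fun _ => .sortSeq) (Sum.elim .colour
      (Sum.elim (fun p => .graph p.1 p.2) .eval))))) (by
      rintro (n | n | _ | c | ⟨n, y⟩ | n)
      exacts [⟨.inl n, rfl⟩, ⟨.inr (.inl n), rfl⟩, ⟨.inr (.inr (.inl ())), rfl⟩,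
        ⟨.inr (.inr (.inr (.inl c))), rfl⟩, ⟨.inr (.inr (.inr (.inr (.inl (n, y))))), rfl⟩,
        ⟨.inr (.inr (.inr (.inr (.inr n)))), rfl⟩])

instance : Nonempty (CodeTag Γ X K) := ⟨.sortSeq⟩

variable [Group Γ] [MulAction Γ X]

open Classical in
/-- The partial maps of the tags, for a family `C` of colours on `X`. -/
def codeTagFun (C : K → Set X) : CodeTag Γ X K → CodeIndex Γ X → Option (CodeIndex Γ X)
  -- The kernels are what matters: the sort tags and colour tags have as kernels the spans of the
  -- selected basis elements, while `graph n y` and `eval n` have as kernels the spans of the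
  -- differences between an argument and its value.
  | .sortGrp n, .grp m γ => if m = n then none else some (.grp m γ)
  | .sortAct n, .act m y => if m = n then none else some (.act m y)
  | .sortSeq, .seq _ => none
  | .colour c, .seq z => if z.lim ∈ C c then none else some (.seq z)
  | .graph n y, .grp m γ => if m = n then some (.act n (γ • y)) else some (.grp m γ)
  | .eval n, .seq z => some (.act n (.inr (z.1 n)))
  | _, b => some b

theorem isTag_codeTagFun (C : K → Set X) (j : CodeTag Γ X K) : IsTag (codeTagFun C j) := by
  intro b b' h
  cases j <;> cases b <;> simp only [codeTagFun] at h <;> (try split_ifs at h) <;>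
    first
    | (cases h; done)
    | (cases h; simp only [codeTagFun]; done)
    | (cases h; simp [codeTagFun, *])


section TagMap

variable {Λ V I A B : Type*} [Ring Λ] [AddCommGroup V] [Module Λ V] {r : I → Option I}

theorem tagMap_mapDomain_of_some {f g : A → I} (h : ∀ a, r (f a) = some (g a)) (v : A →₀ V) :
    tagMap Λ V r (Finsupp.mapDomain f v) = Finsupp.mapDomain g v := by
  induction v using Finsupp.induction_linear with
  | zero => simp
  | add v w hv hw => simp only [Finsupp.mapDomain_add, map_add, hv, hw]
  | single a s =>
    rw [Finsupp.mapDomain_single, Finsupp.mapDomain_single, tagMap_single_of_some (h a)]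

theorem tagMap_mapDomain_of_none {f : A → I} (h : ∀ a, r (f a) = none) (v : A →₀ V) :
    tagMap Λ V r (Finsupp.mapDomain f v) = 0 := by
  induction v using Finsupp.induction_linear with
  | zero => simp
  | add v w hv hw => simp only [Finsupp.mapDomain_add, map_add, hv, hw, add_zero]
  | single a s => rw [Finsupp.mapDomain_single, tagMap_single_of_none (h a)]

theorem tagMap_apply_of_ne_none (h : ∀ b, r b = none ∨ r b = some b) (w : I →₀ V) {b : I}
    (hb : r b ≠ none) : tagMap Λ V r w b = w b := by
  induction w using Finsupp.induction_linear with
  | zero => simp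
  | add v w hv hw => simp only [map_add, Finsupp.add_apply, hv, hw]
  | single a s =>
    rcases h a with ha | ha
    · rw [tagMap_single_of_none ha, Finsupp.zero_apply, Finsupp.single_eq_of_ne]
      rintro rfl
      exact hb ha
    · rw [tagMap_single_of_some ha]

theorem exists_mapDomain_of_tagMap_eq_zero {f : A → I} (hf : Function.Injective f)
    (h1 : ∀ b, r b = none ∨ r b = some b) (h2 : ∀ b, r b = none → b ∈ Set.range f)
    {w : I →₀ V} (hw : tagMap Λ V r w = 0) :
    Finsupp.mapDomain f (Finsupp.comapDomain f w hf.injOn) = w := by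
  refine Finsupp.mapDomain_comapDomain f hf w fun b hb => h2 b ?_
  by_contra h
  rw [Finset.mem_coe, Finsupp.mem_support_iff, ← tagMap_apply_of_ne_none (Λ := Λ) h1 w h, hw] at hb
  exact hb rfl

/-- A linear map compatible with a sort restricts to this sort. -/
theorem exists_restrict {f : A → I} (hf : Function.Injective f) {r' : I → Option I}
    (h : ∀ a, r (f a) = none) (h1 : ∀ b, r' b = none ∨ r' b = some b)
    (h2 : ∀ b, r' b = none → b ∈ Set.range f) (σ : (I →₀ V) →ₗ[Λ] (I →₀ V))
    (hσ : ∀ w, tagMap Λ V r w = 0 → tagMap Λ V r' (σ w) = 0) :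
    ∃ α : (A →₀ V) →ₗ[Λ] (A →₀ V), ∀ v,
      σ (Finsupp.mapDomain f v) = Finsupp.mapDomain f (α v) :=
  ⟨Finsupp.lcomapDomain f hf ∘ₗ σ ∘ₗ Finsupp.lmapDomain V Λ f, fun v =>
    (exists_mapDomain_of_tagMap_eq_zero hf h1 h2 (hσ _ (tagMap_mapDomain_of_none h v))).symm⟩

/-- A linear map compatible with the graph of a map between two sorts commutes with this map. -/
theorem mapDomain_comm_of_graph {f : A → I} {g : B → I} {q : A → B} {r' : I → Option I}
    (hg : Function.Injective g) (hrf : ∀ a, r (f a) = some (g (q a)))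
    (hrg : ∀ b, r (g b) = some (g b)) (hrf' : ∀ a, r' (f a) = some (g (q a)))
    (hrg' : ∀ b, r' (g b) = some (g b)) {σ : (I →₀ V) →ₗ[Λ] (I →₀ V)}
    (hσ : ∀ w, tagMap Λ V r w = 0 → tagMap Λ V r' (σ w) = 0) {α : (A →₀ V) →ₗ[Λ] (A →₀ V)}
    {β : (B →₀ V) →ₗ[Λ] (B →₀ V)} (hα : ∀ v, σ (Finsupp.mapDomain f v) = Finsupp.mapDomain f (α v))
    (hβ : ∀ v, σ (Finsupp.mapDomain g v) = Finsupp.mapDomain g (β v)) (v : A →₀ V) :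
    β (Finsupp.mapDomain q v) = Finsupp.mapDomain q (α v) := by
  -- The difference between a vector on the first sort and its image on the second lies in the
  -- kernel of the graph tag.
  have h1 := hσ (Finsupp.mapDomain f v - Finsupp.mapDomain g (Finsupp.mapDomain q v)) (by
    rw [map_sub, tagMap_mapDomain_of_some hrf, tagMap_mapDomain_of_some hrg,
      ← Finsupp.mapDomain_comp]
    exact sub_self _)
  rw [map_sub, map_sub, hα, hβ, tagMap_mapDomain_of_some hrf', tagMap_mapDomain_of_some hrg',
    sub_eq_zero] at h1
  refine Finsupp.mapDomain_injective hg ?_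
  rw [← h1, ← Finsupp.mapDomain_comp]
  rfl

end TagMap

section Decode

variable {Λ V : Type*} [Ring Λ] [AddCommGroup V] [Module Λ V] {C C' : K → Set X}

/-- Linear maps compatible with the tags. -/
def TagHom (C C' : K → Set X) (σ : (CodeIndex Γ X →₀ V) →ₗ[Λ] (CodeIndex Γ X →₀ V)) : Prop :=
  ∀ (j : CodeTag Γ X K) w, tagMap Λ V (codeTagFun C j) w = 0 →
    tagMap Λ V (codeTagFun C' j) (σ w) = 0

variable {σ : (CodeIndex Γ X →₀ V) →ₗ[Λ] (CodeIndex Γ X →₀ V)}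

theorem TagHom.exists_grp (hσ : TagHom C C' σ) (n : ℕ) :
    ∃ α : (Γ →₀ V) →ₗ[Λ] (Γ →₀ V), ∀ v,
      σ (Finsupp.mapDomain (.grp n) v) = Finsupp.mapDomain (.grp n) (α v) := by
  refine exists_restrict (fun _ _ h => by cases h; rfl) (fun a => ?_) (fun b => ?_) (fun b => ?_) σ
    (hσ (.sortGrp n))
  · simp [codeTagFun]
  · cases b <;> simp [codeTagFun, em]
  · cases b <;> simp [codeTagFun]
    exact fun h => h.symm

theorem TagHom.exists_act (hσ : TagHom C C' σ) (n : ℕ) :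
    ∃ β : (Γ ⊕ X →₀ V) →ₗ[Λ] (Γ ⊕ X →₀ V), ∀ v,
      σ (Finsupp.mapDomain (.act n) v) = Finsupp.mapDomain (.act n) (β v) := by
  refine exists_restrict (fun _ _ h => by cases h; rfl) (fun a => ?_) (fun b => ?_) (fun b => ?_) σ
    (hσ (.sortAct n))
  · simp [codeTagFun]
  · cases b <;> simp [codeTagFun, em]
  · cases b <;> simp [codeTagFun]
    exact fun h => h.symm

theorem TagHom.exists_seq (hσ : TagHom C C' σ) :
    ∃ θ : (EvConst X →₀ V) →ₗ[Λ] (EvConst X →₀ V), ∀ v,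
      σ (Finsupp.mapDomain .seq v) = Finsupp.mapDomain .seq (θ v) := by
  refine exists_restrict (fun _ _ h => by cases h; rfl) (fun a => ?_) (fun b => ?_) (fun b => ?_) σ
    (hσ .sortSeq)
  · simp [codeTagFun]
  · cases b <;> simp [codeTagFun]
  · cases b <;> simp [codeTagFun]

theorem TagHom.graph (hσ : TagHom C C' σ) {n : ℕ} {α : (Γ →₀ V) →ₗ[Λ] (Γ →₀ V)}
    {β : (Γ ⊕ X →₀ V) →ₗ[Λ] (Γ ⊕ X →₀ V)}
    (hα : ∀ v, σ (Finsupp.mapDomain (.grp n) v) = Finsupp.mapDomain (.grp n) (α v))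
    (hβ : ∀ v, σ (Finsupp.mapDomain (.act n) v) = Finsupp.mapDomain (.act n) (β v)) (y : Γ ⊕ X)
    (v : Γ →₀ V) :
    β (Finsupp.mapDomain (· • y) v) = Finsupp.mapDomain (· • y) (α v) := by
  refine mapDomain_comm_of_graph (fun _ _ h => by cases h; rfl) (fun a => ?_) (fun a => ?_)
    (fun a => ?_) (fun a => ?_) (hσ (.graph n y)) hα hβ v <;> simp [codeTagFun]

theorem TagHom.eval (hσ : TagHom C C' σ) (n : ℕ) {θ : (EvConst X →₀ V) →ₗ[Λ] (EvConst X →₀ V)}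
    {β : (Γ ⊕ X →₀ V) →ₗ[Λ] (Γ ⊕ X →₀ V)}
    (hθ : ∀ v, σ (Finsupp.mapDomain .seq v) = Finsupp.mapDomain .seq (θ v))
    (hβ : ∀ v, σ (Finsupp.mapDomain (.act n) v) = Finsupp.mapDomain (.act n) (β v))
    (v : EvConst X →₀ V) :
    β (Finsupp.mapDomain (fun z => .inr (z.1 n)) v) =
      Finsupp.mapDomain (fun z => .inr (z.1 n)) (θ v) := by
  refine mapDomain_comm_of_graph (fun _ _ h => by cases h; rfl) (fun a => ?_) (fun a => ?_)
    (fun a => ?_) (fun a => ?_) (hσ (.eval n)) hθ hβ v <;> simp [codeTagFun]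

/-- The graph at `inl 1` embeds `Γ`, and the graph at `inl γ` is right translation by `γ` followed
by that embedding; both graphs are respected. This is the role of the regular summand in `Γ ⊕ X`. -/
theorem TagHom.grp_comm (hσ : TagHom C C' σ) {n : ℕ} {α : (Γ →₀ V) →ₗ[Λ] (Γ →₀ V)}
    (hα : ∀ v, σ (Finsupp.mapDomain (.grp n) v) = Finsupp.mapDomain (.grp n) (α v)) (γ : Γ)
    (v : Γ →₀ V) : α (Finsupp.mapDomain (· * γ) v) = Finsupp.mapDomain (· * γ) (α v) := by
  obtain ⟨β, hβ⟩ := hσ.exists_act n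
  have h1 : Function.Injective fun δ : Γ => δ • (Sum.inl 1 : Γ ⊕ X) := fun δ ε h => by
    simpa [Sum.smul_inl] using h
  have h2 : ∀ w : Γ →₀ V, Finsupp.mapDomain (· • (Sum.inl 1 : Γ ⊕ X))
      (Finsupp.mapDomain (· * γ) w) = Finsupp.mapDomain (· • (Sum.inl γ : Γ ⊕ X)) w := fun w => by
    rw [← Finsupp.mapDomain_comp]
    congr 1
    funext δ
    simp [Sum.smul_inl]
  apply Finsupp.mapDomain_injective h1
  rw [← hσ.graph hα hβ, h2, hσ.graph hα hβ, h2]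

/-- Automorphisms compatible with the tags act on the group sorts by translations. -/
theorem TagHom.exists_translation [TwoUniqueProds Γ] (D : DenominatorSystem Λ V)
    {σ : (CodeIndex Γ X →₀ V) ≃ₗ[Λ] (CodeIndex Γ X →₀ V)} (hσ : TagHom C C' σ.toLinearMap)
    (hσ' : TagHom C' C σ.symm.toLinearMap) (n : ℕ) :
    ∃ δ : Γ, ∀ y s, ∃ s', σ (Finsupp.single (.act n y) s) = Finsupp.single (.act n (δ • y)) s' := by
  obtain ⟨α, hα⟩ := hσ.exists_grp n
  obtain ⟨α', hα'⟩ := hσ'.exists_grp n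
  obtain ⟨β, hβ⟩ := hσ.exists_act n
  have hinv : ∀ v, α' (α v) = v := fun v => by
    apply Finsupp.mapDomain_injective (f := CodeIndex.grp (X := X) n) fun _ _ h => by cases h; rfl
    rw [← hα', ← hα]
    exact σ.symm_apply_apply _
  obtain ⟨δ, hδ⟩ := exists_single_of_equivariant D hinv (hσ'.grp_comm hα')
  refine ⟨δ, fun y s => ?_⟩
  obtain ⟨s', hs'⟩ := hδ s
  refine ⟨s', ?_⟩
  -- The orbit map of `y` sends 1 to `y` and `δ` to `δ • y`, which carries the translation from the
  -- group sort over to `Γ ⊕ X`.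
  have h1 := hσ.graph hα hβ y (Finsupp.single 1 s)
  rw [hs', Finsupp.mapDomain_single, Finsupp.mapDomain_single, one_smul] at h1
  have h2 := hβ (Finsupp.single y s)
  rwa [h1, Finsupp.mapDomain_single, Finsupp.mapDomain_single] at h2

/-- If a compatible map translates the copies of `Γ ⊕ X` by `δ n`, then the translations converge
on `X` and their limit preserves the colours. -/
theorem TagHom.exists_lim (D : DenominatorSystem Λ V) (hσ : TagHom C C' σ)
    (hinj : Function.Injective σ) {δ : ℕ → Γ}
    (hδ : ∀ n y s, ∃ s', σ (Finsupp.single (.act n y) s) = Finsupp.single (.act n (δ n • y)) s')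
    (x : X) : ∃ x', (∀ᶠ n in atTop, δ n • x = x') ∧ ∀ c, x ∈ C c → x' ∈ C' c := by
  classical
  obtain ⟨θ, hθ⟩ := hσ.exists_seq
  choose β hβ using hσ.exists_act
  set v := θ (Finsupp.single (.const x) D.gen) with hv
  have h1 : ∀ n, ∃ s ≠ 0, Finsupp.mapDomain (fun z : EvConst X => (.inr (z.1 n) : Γ ⊕ X)) v =
      Finsupp.single (.inr (δ n • x)) s := fun n => by
    obtain ⟨s, hs⟩ := hδ n (.inr x) D.gen
    refine ⟨s, ?_, ?_⟩
    · rintro rfl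
      rw [Finsupp.single_zero, ← map_zero σ] at hs
      exact D.gen_ne (Finsupp.single_eq_zero.1 (hinj hs))
    · rw [← hσ.eval n hθ (hβ n), Finsupp.mapDomain_single]
      apply Finsupp.mapDomain_injective (f := CodeIndex.act n) fun _ _ h => by cases h; rfl
      rw [← hβ, Finsupp.mapDomain_single, Finsupp.mapDomain_single]
      exact hs
  -- The image `v` of the constant sequence `x` has finite support, so from some `n` on evaluating
  -- it at `n` amounts to taking limits, independently of `n`; its value sits at `δ n • x`, which
  -- therefore stabilises.
  have h2 : ∀ᶠ n in atTop, ∀ z ∈ v.support, z.1 n = z.lim :=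
    (Finset.eventually_all v.support).2 fun z _ => z.eventually_eq_lim
  have h3 : ∀ᶠ n in atTop, ∃ s ≠ 0, Finsupp.mapDomain (fun z : EvConst X => (.inr z.lim : Γ ⊕ X)) v =
      Finsupp.single (.inr (δ n • x)) s := h2.mono fun n hn => by
    obtain ⟨s, hs, h⟩ := h1 n
    refine ⟨s, hs, ?_⟩
    rw [← h]
    exact Finsupp.mapDomain_congr fun z hz => by rw [hn z hz]
  obtain ⟨N, s, hs, hN⟩ := h3.exists
  refine ⟨δ N • x, h3.mono fun n hn => ?_, fun c hc => ?_⟩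
  · obtain ⟨t, ht, h⟩ := hn
    rw [hN] at h
    have := (Finsupp.single_eq_single_iff _ _ _ _).1 h
    rcases this with ⟨h, -⟩ | ⟨h, -⟩
    · exact (Sum.inr_injective h).symm
    · exact absurd h hs
  · have h4 : (.inr (δ N • x) : Γ ⊕ X) ∈
        (Finsupp.mapDomain (fun z : EvConst X => (.inr z.lim : Γ ⊕ X)) v).support := by
      rw [hN, Finsupp.mem_support_iff, Finsupp.single_eq_same]
      exact hs
    -- Some sequence in the support of `v` has limit `x'`; the colour tag forces every sequence in
    -- that support to have its limit in `C' c`.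
    obtain ⟨z, hz, hzx⟩ := Finset.mem_image.1 (Finsupp.mapDomain_support h4)
    rw [← Sum.inr_injective hzx]
    by_contra hcon
    have h5 := hσ (.colour c) (Finsupp.single (.seq (.const x)) D.gen) (tagMap_single_of_none (by
      simp only [codeTagFun, EvConst.lim_const, if_pos hc]) _)
    have h6 := hθ (Finsupp.single (.const x) D.gen)
    rw [Finsupp.mapDomain_single, ← hv] at h6
    rw [h6] at h5
    have h7 := tagMap_apply_of_ne_none (Λ := Λ) (r := codeTagFun (Γ := Γ) C' (.colour c))
      (fun b => by cases b <;> simp [codeTagFun, em]) (Finsupp.mapDomain .seq v) (b := .seq z)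
      (by simp [codeTagFun, hcon])
    rw [h5, Finsupp.mapDomain_apply (fun _ _ h => by cases h; rfl)] at h7
    exact Finsupp.mem_support_iff.1 hz h7.symm

/-- The coding modules of two families of colours are isomorphic if and only if some limit of
translations by elements of `Γ` carries the first family to the second. -/
theorem nonempty_codeModule_equiv_iff [TwoUniqueProds Γ] (D : DenominatorSystem Λ V) {k : CodeTag Γ X K → ℕ}
    (hk : Function.Injective k) (C C' : K → Set X) :
    Nonempty (D.tagModule k (codeTagFun C) ≃ₗ[Λ] D.tagModule k (codeTagFun C')) ↔
      ∃ δ : ℕ → Γ, (∀ x, ∃ x', (∀ᶠ n in atTop, δ n • x = x') ∧ ∀ c, x ∈ C c → x' ∈ C' c) ∧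
        ∀ x, ∃ x', (∀ᶠ n in atTop, (δ n)⁻¹ • x = x') ∧ ∀ c, x ∈ C' c → x' ∈ C c := by
  constructor
  · rintro ⟨f⟩
    obtain ⟨σ, h⟩ := D.exists_linearEquiv_of_tagModule hk (isTag_codeTagFun C)
      (isTag_codeTagFun C') f
    have hσ : TagHom C C' σ.toLinearMap := fun j w hw => (h j w).2 hw
    have hσ' : TagHom C' C σ.symm.toLinearMap := fun j w hw => (h j _).1 (by
      rw [← hw]; congr 1; exact σ.apply_symm_apply w)
    choose δ hδ using hσ.exists_translation D hσ'
    choose δ' hδ' using hσ'.exists_translation D hσ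
    -- Compared on the regular summand, where the action is free.
    have hinv : ∀ n, δ' n = (δ n)⁻¹ := fun n => by
      obtain ⟨s, hs⟩ := hδ n (.inl 1) D.gen
      obtain ⟨s', hs'⟩ := hδ' n (δ n • .inl 1) s
      have h1 : σ.symm (σ (Finsupp.single (.act n (.inl 1)) D.gen)) = _ := σ.symm_apply_apply _
      rw [hs] at h1
      have h2 := hs'.symm.trans h1
      rcases (Finsupp.single_eq_single_iff _ _ _ _).1 h2 with ⟨h, -⟩ | ⟨-, h⟩
      · rw [← mul_smul] at h
        simp only [Sum.smul_inl, CodeIndex.act.injEq, true_and, Sum.inl.injEq, smul_eq_mul,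
          mul_one] at h
        exact eq_inv_of_mul_eq_one_left h
      · exact absurd h D.gen_ne
    refine ⟨δ, hσ.exists_lim D σ.injective hδ, ?_⟩
    simp only [← hinv]
    exact hσ'.exists_lim D σ.symm.injective hδ'
  · rintro ⟨δ, h1, h2⟩
    have tr : ∀ {δ : ℕ → Γ}, (∀ x, ∃ x', ∀ᶠ n in atTop, δ n • x = x') → ∀ z : EvConst X,
        ∃ x, ∀ᶠ n in atTop, δ n • z.1 n = x := fun h z => by
      obtain ⟨x', hx'⟩ := h z.lim
      exact ⟨x', (hx'.and z.eventually_eq_lim).mono fun n hn => by rw [hn.2, hn.1]⟩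
    have t1 := tr fun x => (h1 x).imp fun _ h => h.1
    have t2 := tr fun x => (h2 x).imp fun _ h => h.1
    -- Translate the `n`-th copies by `δ n` and sequences termwise; convergence keeps them
    -- eventually constant.
    let e : CodeIndex Γ X ≃ CodeIndex Γ X :=
      { toFun := fun b => match b with
          | .grp n γ => .grp n (δ n * γ)
          | .act n y => .act n (δ n • y)
          | .seq z => .seq ⟨fun n => δ n • z.1 n, t1 z⟩
        invFun := fun b => match b with
          | .grp n γ => .grp n ((δ n)⁻¹ * γ)
          | .act n y => .act n ((δ n)⁻¹ • y)
          | .seq z => .seq ⟨fun n => (δ n)⁻¹ • z.1 n, t2 z⟩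
        left_inv := by rintro (_ | _ | _) <;> simp
        right_inv := by rintro (_ | _ | _) <;> simp }
    have hcol : ∀ (z : EvConst X) (c : K),
        (⟨fun n => δ n • z.1 n, t1 z⟩ : EvConst X).lim ∈ C' c ↔ z.lim ∈ C c := by
      intro z c
      obtain ⟨x', hx', hc'⟩ := h1 z.lim
      obtain ⟨x'', hx'', hc''⟩ := h2 x'
      have e1 : (⟨fun n => δ n • z.1 n, t1 z⟩ : EvConst X).lim = x' := EvConst.lim_eq
        ((hx'.and z.eventually_eq_lim).mono fun n hn => by rw [← hn.1, ← hn.2])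
      obtain ⟨n, e2, e3⟩ := (hx'.and hx'').exists
      rw [e1]
      rw [← e2, inv_smul_smul] at e3
      exact ⟨fun h => e3 ▸ hc'' c h, hc' c⟩
    refine DenominatorSystem.nonempty_tagModule_equiv e fun j b => ?_
    cases j <;> cases b <;> simp only [codeTagFun, e, Equiv.coe_fn_mk] <;>
      (try split_ifs) <;> first
        | rfl
        | exact absurd ((hcol _ _).1 ‹_›) ‹_›
        | exact absurd ((hcol _ _).2 ‹_›) ‹_›
        | (subst ‹_ = _›; simp [mul_smul])

end Decode

end Code

end

open FirstOrder.Language MeasureTheory Topology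

noncomputable section

/-! ### Borel maps into spaces of structures -/

section Str

variable {L : FirstOrder.Language.{u, v}}

theorem isOpen_funMap (M : Set ℕ) {n : ℕ} (f : L.Functions n) (a : Fin n → ℕ) :
    IsOpen {N : Str L | @Structure.funMap L ℕ N n f a ∈ M} := by
  let t : TopologicalSpace (Str L) := .induced (fun N : Str L => @Structure.funMap L ℕ N n f a) ⊥
  have h : IsOpen[t] {N : Str L | @Structure.funMap L ℕ N n f a ∈ M} := ⟨M, trivial, rfl⟩
  have hle : instTopologicalSpaceStr L ≤ t := by
    unfold instTopologicalSpaceStr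
    exact inf_le_left.trans ((iInf_le _ n).trans ((iInf_le _ f).trans (iInf_le _ a)))
  exact hle _ h

theorem isOpen_relMap (P : Set Prop) {n : ℕ} (r : L.Relations n) (a : Fin n → ℕ) :
    IsOpen {N : Str L | @Structure.RelMap L ℕ N n r a ∈ P} := by
  let t : TopologicalSpace (Str L) := .induced (fun N : Str L => @Structure.RelMap L ℕ N n r a) ⊥
  have h : IsOpen[t] {N : Str L | @Structure.RelMap L ℕ N n r a ∈ P} := ⟨P, trivial, rfl⟩
  have hle : instTopologicalSpaceStr L ≤ t := by
    unfold instTopologicalSpaceStr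
    exact inf_le_right.trans ((iInf_le _ n).trans ((iInf_le _ r).trans (iInf_le _ a)))
  exact hle _ h

instance : BorelSpace (Str L) := ⟨rfl⟩

theorem measurableSet_funMap_eq {n : ℕ} (f : L.Functions n) (a : Fin n → ℕ) (b : ℕ) :
    MeasurableSet {N : Str L | @Structure.funMap L ℕ N n f a = b} :=
  (isOpen_funMap {b} f a).measurableSet

theorem measurableSet_relMap {n : ℕ} (r : L.Relations n) (a : Fin n → ℕ) :
    MeasurableSet {N : Str L | @Structure.RelMap L ℕ N n r a} := by
  have h := (isOpen_relMap {True} r a).measurableSet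
  simpa only [Set.mem_singleton_iff, eq_iff_iff, iff_true] using h

variable (L) in
/-- The canonical subbasis of the topology of `Str L`. -/
def strSubbasis : Set (Set (Str L)) :=
  Set.range (fun p : Σ q : Σ n, L.Functions n, (Fin q.1 → ℕ) × ℕ =>
    {N : Str L | @Structure.funMap L ℕ N p.1.1 p.1.2 p.2.1 = p.2.2}) ∪
  Set.range (fun p : Σ q : Σ n, L.Relations n, (Fin q.1 → ℕ) × Prop =>
    {N : Str L | @Structure.RelMap L ℕ N p.1.1 p.1.2 p.2.1 = p.2.2})

theorem isOpen_preimage_of_singleton {α β : Type*} [TopologicalSpace α] {g : α → β}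
    (h : ∀ b, IsOpen {x | g x = b}) (s : Set β) : IsOpen (g ⁻¹' s) := by
  have : g ⁻¹' s = ⋃ b ∈ s, {x | g x = b} := by ext; simp
  rw [this]
  exact isOpen_biUnion fun b _ => h b

theorem topology_eq_generateFrom :
    (inferInstance : TopologicalSpace (Str L)) = .generateFrom (strSubbasis L) := by
  apply le_antisymm
  · apply le_generateFrom
    rintro _ (⟨p, rfl⟩ | ⟨p, rfl⟩)
    exacts [isOpen_funMap {_} _ _, isOpen_relMap {_} _ _]
  · refine le_inf (le_iInf fun n => le_iInf fun f => le_iInf fun a => ?_)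
      (le_iInf fun n => le_iInf fun f => le_iInf fun a => ?_)
    · rintro _ ⟨s, -, rfl⟩
      let _ := TopologicalSpace.generateFrom (strSubbasis L)
      exact isOpen_preimage_of_singleton (fun b =>
        TopologicalSpace.isOpen_generateFrom_of_mem (Or.inl ⟨⟨⟨n, f⟩, a, b⟩, rfl⟩)) s
    · rintro _ ⟨s, -, rfl⟩
      let _ := TopologicalSpace.generateFrom (strSubbasis L)
      exact isOpen_preimage_of_singleton (fun b =>
        TopologicalSpace.isOpen_generateFrom_of_mem (Or.inr ⟨⟨⟨n, f⟩, a, b⟩, rfl⟩)) s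

theorem countable_strSubbasis [Countable L.Symbols] : (strSubbasis L).Countable := by
  have : Countable (Σ n, L.Functions n) := Function.Injective.countable
    (β := L.Symbols) (f := Sum.inl) Sum.inl_injective
  have : Countable (Σ n, L.Relations n) := Function.Injective.countable
    (β := L.Symbols) (f := Sum.inr) Sum.inr_injective
  exact (Set.countable_range _).union (Set.countable_range _)

/-- For a countable language the atomic conditions form a countable subbasis, so they generate the
Borel σ-algebra. -/
theorem measurable_str [Countable L.Symbols] {α : Type*} [MeasurableSpace α] {F : α → Str L}
    (h : ∀ (n : ℕ) (f : L.Functions n) (a : Fin n → ℕ) (b : ℕ),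
      MeasurableSet {x | @Structure.funMap L ℕ (F x) n f a = b})
    (h' : ∀ (n : ℕ) (r : L.Relations n) (a : Fin n → ℕ),
      MeasurableSet {x | @Structure.RelMap L ℕ (F x) n r a}) : Measurable F := by
  have : SecondCountableTopology (Str L) := ⟨⟨_, countable_strSubbasis, topology_eq_generateFrom⟩⟩
  have h1 : (inferInstance : MeasurableSpace (Str L)) = .generateFrom (strSubbasis L) :=
    borel_eq_generateFrom_of_subbasis topology_eq_generateFrom
  change @Measurable _ _ _ (inferInstance : MeasurableSpace (Str L)) F
  rw [h1]
  refine measurable_generateFrom ?_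
  rintro _ (⟨p, rfl⟩ | ⟨p, rfl⟩)
  · exact h _ _ _ _
  · by_cases hp : p.2.2
    · convert h' _ p.1.2 p.2.1 using 1
      ext
      simp [hp]
    · convert (h' _ p.1.2 p.2.1).compl using 1
      ext
      simp [hp]

end Str

/-! ### Modules as structures on `ℕ` -/

section ModuleStr

variable {Λ : Type u} [Ring Λ] {N N' : Type*} [AddCommGroup N] [Module Λ N] [AddCommGroup N']
  [Module Λ N']

instance [Countable Λ] : Countable (moduleLang Λ).Symbols := by
  refine Function.Surjective.countable (α := Option (Option Λ)) (f := fun o => match o with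
    | none => .inl ⟨0, (ModuleFunc.zero : ModuleFunc Λ 0)⟩
    | some none => .inl ⟨2, (ModuleFunc.add : ModuleFunc Λ 2)⟩
    | some (some r) => .inl ⟨1, (ModuleFunc.smul r : ModuleFunc Λ 1)⟩) ?_
  rintro (⟨n, f⟩ | ⟨n, r⟩)
  · cases f with
    | zero => exact ⟨none, rfl⟩
    | add => exact ⟨some none, rfl⟩
    | smul r => exact ⟨some (some r), rfl⟩
  · exact r.elim

/-- The structure on `ℕ` transported from a module along a bijection. -/
def moduleStr (e : ℕ ≃ N) : Str (moduleLang Λ) where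
  funMap {n} f := match n, f with
    | _, .zero => fun _ => e.symm 0
    | _, .add => fun a => e.symm (e (a 0) + e (a 1))
    | _, .smul r => fun a => e.symm ((r : Λ) • e (a 0))
  RelMap {_} r := r.elim

theorem moduleStr_mem_mod (e : ℕ ≃ N) : moduleStr e ∈ Mod (moduleTheory Λ) := by
  intro φ hφ
  cases hφ with
  | add_assoc =>
    intro x y z
    change e.symm (e (e.symm (e x + e y)) + e z) = e.symm (e x + e (e.symm (e y + e z)))
    simp [add_assoc]
  | add_comm =>
    intro x y
    change e.symm (e x + e y) = e.symm (e y + e x)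
    rw [add_comm]
  | add_zero =>
    intro x
    change e.symm (e x + e (e.symm 0)) = x
    simp
  | add_neg =>
    intro x h
    refine h (e.symm (- e x)) ?_
    change e.symm (e x + e (e.symm (- e x))) = e.symm 0
    simp
  | smul_add r =>
    intro x y
    change e.symm (r • e (e.symm (e x + e y))) =
      e.symm (e (e.symm (r • e x)) + e (e.symm (r • e y)))
    simp
  | add_smul r s =>
    intro x
    change e.symm ((r + s) • e x) = e.symm (e (e.symm (r • e x)) + e (e.symm (s • e x)))
    simp [add_smul]
  | mul_smul r s =>
    intro x
    change e.symm ((r * s) • e x) = e.symm (r • e (e.symm (s • e x)))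
    simp [mul_smul]
  | one_smul =>
    intro x
    change e.symm ((1 : Λ) • e x) = x
    simp

theorem iso_moduleStr_iff (e : ℕ ≃ N) (e' : ℕ ≃ N') :
    Iso (moduleStr (Λ := Λ) e) (moduleStr e') ↔ Nonempty (N ≃ₗ[Λ] N') := by
  constructor
  · rintro ⟨⟨φ, hφ, -⟩⟩
    have hadd : ∀ a b : ℕ, φ (e.symm (e a + e b)) = e'.symm (e' (φ a) + e' (φ b)) := fun a b =>
      hφ (ModuleFunc.add : ModuleFunc Λ 2) ![a, b]
    have hsmul : ∀ (r : Λ) (a : ℕ), φ (e.symm (r • e a)) = e'.symm (r • e' (φ a)) := fun r a =>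
      hφ (ModuleFunc.smul r : ModuleFunc Λ 1) ![a]
    refine ⟨{ (e.symm.trans φ).trans e' with
      map_add' := fun x y => ?_, map_smul' := fun r x => ?_ }⟩
    · have := hadd (e.symm x) (e.symm y)
      simp only [Equiv.apply_symm_apply] at this
      simp [this]
    · have := hsmul r (e.symm x)
      simp only [Equiv.apply_symm_apply] at this
      simp [this]
  · rintro ⟨φ⟩
    refine ⟨@FirstOrder.Language.Equiv.mk _ _ _ (moduleStr e) (moduleStr e')
      ((e.trans φ.toEquiv).trans e'.symm) (fun {n} f => ?_) fun {n} r => r.elim⟩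
    cases f with
    | zero =>
      intro a
      change e'.symm (φ (e (e.symm 0))) = e'.symm 0
      simp
    | add =>
      intro a
      change e'.symm (φ (e (e.symm (e (a 0) + e (a 1))))) =
        e'.symm (e' (e'.symm (φ (e (a 0)))) + e' (e'.symm (φ (e (a 1)))))
      simp
    | smul r =>
      intro a
      change e'.symm (φ (e (e.symm (r • e (a 0))))) = e'.symm (r • e' (e'.symm (φ (e (a 0)))))
      simp

end ModuleStr

/-! ### Borel enumeration of infinite submodules -/

section Enumeration

variable {W : Type*} (ι : W → ℕ)

open Classical in
/-- The rank of an element in the enumeration of a set induced by `ι`. -/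
def rank (s : Set W) (w : W) : ℕ := Nat.count (· ∈ ι '' s) (ι w)

variable {ι}

theorem rank_bijective (hι : Function.Injective ι) {s : Set W} (hs : s.Infinite) :
    Function.Bijective fun w : s => rank ι s w := by
  classical
  constructor
  · intro w w' h
    exact Subtype.ext (hι (Nat.count_injective (Set.mem_image_of_mem _ w.2)
      (Set.mem_image_of_mem _ w'.2) h))
  · intro n
    have hinf : (Set.ofPred (· ∈ ι '' s)).Infinite := hs.image hι.injOn
    obtain ⟨w, hw, h⟩ := Nat.nth_mem_of_infinite hinf n
    refine ⟨⟨w, hw⟩, ?_⟩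
    change Nat.count _ (ι w) = n
    rw [h]
    convert Nat.count_nth_of_infinite hinf n

/-- A rank is a finite sum of indicators of measurable conditions. -/
theorem measurableSet_rank_eq [Countable W] {α : Type*} [MeasurableSpace α] {s : α → Set W}
    (hs : ∀ w, MeasurableSet {x | w ∈ s x}) (w : W) (n : ℕ) :
    MeasurableSet {x | rank ι (s x) w = n} := by
  classical
  have h1 : ∀ k, MeasurableSet {x | k ∈ ι '' s x} := fun k => by
    have : {x | k ∈ ι '' s x} = ⋃ w, {x | w ∈ s x ∧ ι w = k} := by ext; simp
    rw [this]
    exact .iUnion fun w => (hs w).inter (.const _)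
  have h2 : ∀ k, Measurable fun x => Nat.count (· ∈ ι '' s x) k := fun k => by
    induction k with
    | zero => simp only [Nat.count_zero]; exact measurable_const
    | succ k ih =>
      simp only [Nat.count_succ]
      exact ih.add (Measurable.ite (h1 k) measurable_const measurable_const)
  convert h2 (ι w) (measurableSet_singleton n) using 1
  ext x
  simp only [rank, Set.mem_ofPred_eq, Set.mem_preimage, Set.mem_singleton_iff]

/-- A Borel family of infinite submodules of a countable module, which are isomorphic if and only
if the given structures are, gives a Borel reduction to the theory of modules. -/
theorem borelReducible_of_submodule {L' : FirstOrder.Language.{u', v'}} {S : Set (InfSentence L')}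
    {Λ : Type u} [Ring Λ] [Countable Λ] [Countable W] [AddCommGroup W] [Module Λ W]
    (G : Str L' → Submodule Λ W) (hinf : ∀ M, (G M : Set W).Infinite)
    (hmeas : ∀ w, MeasurableSet {M | w ∈ G M})
    (hiso : ∀ M N, Nonempty (G M ≃ₗ[Λ] G N) ↔ Iso M N) :
    BorelReducible S (moduleTheory Λ) := by
  obtain ⟨ι, hι⟩ := exists_injective_nat W
  let e (M : Str L') : ℕ ≃ G M := (Equiv.ofBijective _ (rank_bijective hι (hinf M))).symm
  have he : ∀ M (w : G M), (e M).symm w = rank ι (G M) w := fun M w => rfl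
  have he' : ∀ M n w, (e M n : W) = w ↔ w ∈ G M ∧ rank ι (G M) w = n := by
    intro M n w
    constructor
    · rintro rfl
      exact ⟨Subtype.prop _, by rw [← he, Equiv.symm_apply_apply]⟩
    · rintro ⟨h, h'⟩
      rw [← he M ⟨w, h⟩, Equiv.symm_apply_eq] at h'
      rw [← h']
  have hrank := fun w n => measurableSet_rank_eq (ι := ι) (s := fun M => (G M : Set W)) hmeas w n
  have henum : ∀ n w, MeasurableSet {M | (e M n : W) = w} := fun n w => by
    simp only [he']
    exact (hmeas w).inter (hrank w n)
  have hF : Measurable fun M => (moduleStr (Λ := Λ) (e M)) := by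
    refine measurable_str (fun n f a b => ?_) fun _ r => r.elim
    cases f with
    | zero => exact hrank 0 b
    | add =>
      -- Splitting over the countably many possible values of the two enumerated elements leaves
      -- only membership and rank conditions.
      have : {M | @Structure.funMap _ ℕ (moduleStr (Λ := Λ) (e M)) 2
          (ModuleFunc.add : ModuleFunc Λ 2) a = b} = ⋃ w, ⋃ w',
            {M | ((e M (a 0) : W) = w ∧ (e M (a 1) : W) = w') ∧ rank ι (G M) (w + w') = b} := by
        ext M
        simp only [Set.mem_iUnion, Set.mem_ofPred_eq]
        constructor
        · exact fun h => ⟨_, _, ⟨rfl, rfl⟩, h⟩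
        · rintro ⟨_, _, ⟨rfl, rfl⟩, h⟩
          exact h
      rw [this]
      exact .iUnion fun w => .iUnion fun w' =>
        ((henum _ w).inter (henum _ w')).inter (hrank _ b)
    | smul r =>
      have : {M | @Structure.funMap _ ℕ (moduleStr (Λ := Λ) (e M)) 1
          (ModuleFunc.smul r : ModuleFunc Λ 1) a = b} = ⋃ w,
            {M | (e M (a 0) : W) = w ∧ rank ι (G M) (r • w) = b} := by
        ext M
        simp only [Set.mem_iUnion, Set.mem_ofPred_eq]
        constructor
        · exact fun h => ⟨_, rfl, h⟩
        · rintro ⟨_, rfl, h⟩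
          exact h
      rw [this]
      exact .iUnion fun w => (henum _ w).inter (hrank _ b)
  exact ⟨fun M => ⟨moduleStr (e M), moduleStr_mem_mod _⟩,
    (hF.comp measurable_subtype_coe).subtype_mk, fun M N =>
    (iso_moduleStr_iff _ _).trans (hiso M N)⟩

end Enumeration

/-! ### The coding modules depend on the colours in a Borel way -/

section TagModule

variable {Λ V : Type*} [Ring Λ] [AddCommGroup V] [Module Λ V]

/-- Membership in a span is witnessed by a finite set of generators, and a countable module has
countably many finite subsets. -/
theorem measurableSet_mem_span {W : Type*} [AddCommGroup W] [Module Λ W] [Countable W] {α : Type*}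
    [MeasurableSpace α] {T : α → Set W} (h : ∀ w, MeasurableSet {x | w ∈ T x}) (w : W) :
    MeasurableSet {x | w ∈ Submodule.span Λ (T x)} := by
  have : {x | w ∈ Submodule.span Λ (T x)} = ⋃ F : Finset W,
      {x | (F : Set W) ⊆ T x ∧ w ∈ Submodule.span Λ (F : Set W)} := by
    ext x
    simp only [Set.mem_iUnion, Set.mem_ofPred_eq]
    exact ⟨Submodule.mem_span_finite_of_mem_span, fun ⟨F, h1, h2⟩ => Submodule.span_mono h1 h2⟩
  rw [this]
  refine .iUnion fun F => .inter ?_ (.const _)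
  have : {x | (F : Set W) ⊆ T x} = ⋂ v ∈ F, {x | v ∈ T x} := by
    ext x
    simp [Set.subset_def]
  change MeasurableSet {x | (F : Set W) ⊆ T x}
  rw [this]
  exact Finset.measurableSet_biInter F fun v _ => h v

theorem measurableSet_mem_tagModule (D : DenominatorSystem Λ V) {I J : Type*} [Countable I]
    [Countable J] [Countable V] {α : Type*} [MeasurableSpace α] {k : J → ℕ}
    {r : α → J → I → Option I} (hr : ∀ j b o, MeasurableSet {x | r x j b = o}) (w : I →₀ V) :
    MeasurableSet {x | w ∈ D.tagModule k (r x)} := by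
  have : Countable (I →₀ V) := inferInstance
  refine measurableSet_mem_span (fun w => .union (.const _) ?_) w
  have h1 : ∀ (q : I → Option I) (b : I), tagMap Λ V q (Finsupp.single b D.gen) =
      (q b).elim 0 fun b' => Finsupp.single b' D.gen := fun q b => by
    cases h : q b with
    | none => exact tagMap_single_of_none h _
    | some b' => exact tagMap_single_of_some h _
  have h2 : {x | w ∈ {w | ∃ (j : J) (m : ℕ) (b : I), D.p (k j) ^ m • w =
      Finsupp.single b D.gen - tagMap Λ V (r x j) (Finsupp.single b D.gen)}} =
      ⋃ (j : J) (m : ℕ) (b : I) (o : Option I), {x | r x j b = o ∧ D.p (k j) ^ m • w =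
        Finsupp.single b D.gen - o.elim 0 fun b' => Finsupp.single b' D.gen} := by
    ext x
    simp only [Set.mem_iUnion, Set.mem_ofPred_eq, h1]
    constructor
    · rintro ⟨j, m, b, h⟩
      exact ⟨j, m, b, _, rfl, h⟩
    · rintro ⟨j, m, b, _, rfl, h⟩
      exact ⟨j, m, b, h⟩
  change MeasurableSet {x | w ∈ {w | ∃ (j : J) (m : ℕ) (b : I), D.p (k j) ^ m • w =
      Finsupp.single b D.gen - tagMap Λ V (r x j) (Finsupp.single b D.gen)}}
  rw [h2]
  exact .iUnion fun j => .iUnion fun m => .iUnion fun b => .iUnion fun o =>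
    (hr j b o).inter (.const _)

theorem measurableSet_codeTagFun {Γ X K : Type*} [Group Γ] [MulAction Γ X] {α : Type*}
    [MeasurableSpace α] {C : α → K → Set X} (hC : ∀ c x, MeasurableSet {y | x ∈ C y c})
    (j : CodeTag Γ X K) (b : CodeIndex Γ X) (o : Option (CodeIndex Γ X)) :
    MeasurableSet {y | codeTagFun (C y) j b = o} := by
  classical
  cases j with
  | colour c =>
    cases b with
    | seq z =>
      have : {y | codeTagFun (Γ := Γ) (C y) (.colour c) (.seq z) = o} =
          ({y | z.lim ∈ C y c} ∩ {_y | none = o}) ∪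
            ({y | z.lim ∈ C y c}ᶜ ∩ {_y | some (.seq z) = o}) := by
        ext y
        by_cases h : z.lim ∈ C y c <;> simp [codeTagFun, h]
      rw [this]
      exact ((hC c _).inter (.const _)).union ((hC c _).compl.inter (.const _))
    | grp => simp only [codeTagFun]; exact .const _
    | act => simp only [codeTagFun]; exact .const _
  | _ => cases b <;> simp only [codeTagFun] <;> exact .const _

end TagModule

end

/-! ### Structures as colours on finite lists -/

open FirstOrder.Language Filter

noncomputable section

variable {L' : FirstOrder.Language.{u', v'}}

/-- The colours of tuples coding a structure. -/
def strColour (M : Str L') : L'.Symbols → Set (List ℕ)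
  | .inl f => {l | ∃ a, l = @Structure.funMap L' ℕ M f.1 f.2 a :: List.ofFn a}
  | .inr r => {l | ∃ a, @Structure.RelMap L' ℕ M r.1 r.2 a ∧ l = List.ofFn a}

theorem measurableSet_mem_strColour (c : L'.Symbols) (l : List ℕ) :
    MeasurableSet {M : Str L' | l ∈ strColour M c} := by
  rcases c with ⟨n, f⟩ | ⟨n, r⟩
  · have : {M : Str L' | l ∈ strColour M (.inl ⟨n, f⟩)} =
        ⋃ (a : Fin n → ℕ) (b : ℕ), {M : Str L' | @Structure.funMap L' ℕ M n f a = b ∧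
          l = b :: List.ofFn a} := by
      ext M
      simp only [Set.mem_iUnion, Set.mem_ofPred_eq]
      constructor
      · rintro ⟨a, h⟩
        exact ⟨a, _, rfl, h⟩
      · rintro ⟨a, _, rfl, h⟩
        exact ⟨a, h⟩
    rw [this]
    exact .iUnion fun a => .iUnion fun b => (measurableSet_funMap_eq f a b).inter (.const _)
  · have : {M : Str L' | l ∈ strColour M (.inr ⟨n, r⟩)} =
        ⋃ a : Fin n → ℕ, {M : Str L' | @Structure.RelMap L' ℕ M n r a ∧ l = List.ofFn a} := by
      ext M
      simp only [Set.mem_iUnion, Set.mem_ofPred_eq]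
      rfl
    rw [this]
    exact .iUnion fun a => (measurableSet_relMap r a).inter (.const _)

theorem map_mem_strColour {M N : Str L'} (φ : @FirstOrder.Language.Equiv L' ℕ ℕ M N) {l : List ℕ}
    {c : L'.Symbols} (h : l ∈ strColour M c) : l.map (@FirstOrder.Language.Equiv.toEquiv L' ℕ ℕ M N φ) ∈ strColour N c := by
  obtain ⟨φ, hf, hr⟩ := φ
  rcases c with ⟨n, f⟩ | ⟨n, r⟩
  · obtain ⟨a, rfl⟩ := h
    refine ⟨φ ∘ a, ?_⟩
    rw [List.map_cons, List.map_ofFn]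
    congr 1
    exact hf f a
  · obtain ⟨a, h, rfl⟩ := h
    refine ⟨φ ∘ a, (hr r a).2 h, ?_⟩
    rw [List.map_ofFn]

/-- The image of `f(a) :: a` has the form `f(b) :: b`, and comparing tails gives `b = π ∘ a`.
Relations need both directions, since colours are only assumed to be carried forward. -/
theorem iso_of_strColour {M N : Str L'} (π : Equiv.Perm ℕ)
    (h : ∀ l c, l ∈ strColour M c → l.map π ∈ strColour N c)
    (h' : ∀ l c, l ∈ strColour N c → l.map π.symm ∈ strColour M c) : Iso M N := by
  refine ⟨@FirstOrder.Language.Equiv.mk _ _ _ M N π (fun {n} f a => ?_) fun {n} r a => ⟨fun hr => ?_,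
    fun hr => ?_⟩⟩
  · obtain ⟨b, hb⟩ := h (@Structure.funMap L' ℕ M n f a :: List.ofFn a) (.inl ⟨n, f⟩) ⟨a, rfl⟩
    rw [List.map_cons, List.map_ofFn, List.cons.injEq] at hb
    have := List.ofFn_injective hb.2
    rw [← this] at hb
    exact hb.1
  · obtain ⟨b, hr', hb⟩ := h' (List.ofFn (π ∘ a)) (.inr ⟨n, r⟩) ⟨_, hr, rfl⟩
    rw [List.map_ofFn] at hb
    have := List.ofFn_injective hb
    rw [← this] at hr'
    convert hr' using 1
    funext i
    simp
  · obtain ⟨b, hr', hb⟩ := h (List.ofFn a) (.inr ⟨n, r⟩) ⟨_, hr, rfl⟩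
    rw [List.map_ofFn] at hb
    have := List.ofFn_injective hb
    rw [← this] at hr'
    exact hr'

theorem eventually_map_eq {π : ℕ → ℕ → ℕ} {ρ : ℕ → ℕ} (h : ∀ a, ∀ᶠ n in atTop, π n a = ρ a)
    (l : List ℕ) : ∀ᶠ n in atTop, l.map (π n) = l.map ρ := by
  induction l with
  | nil => exact Eventually.of_forall fun _ => rfl
  | cons a l ih =>
    filter_upwards [h a, ih] with n h1 h2
    rw [List.map_cons, List.map_cons, h1, h2]

theorem eq_of_eventually_eq {α : Type*} {z : ℕ → α} {x y : α} (h : ∀ᶠ n in atTop, z n = x)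
    (h' : ∀ᶠ n in atTop, z n = y) : x = y := by
  obtain ⟨n, h1, h2⟩ := (h.and h').exists
  exact h1.symm.trans h2

theorem exists_limit {π : ℕ → ℕ → ℕ} {P : List ℕ → List ℕ → Prop}
    (h : ∀ l : List ℕ, ∃ l', (∀ᶠ n in atTop, l.map (π n) = l') ∧ P l l') :
    ∃ ρ : ℕ → ℕ, (∀ a, ∀ᶠ n in atTop, π n a = ρ a) ∧ ∀ l, P l (l.map ρ) := by
  have h1 : ∀ a, ∃ b, ∀ᶠ n in atTop, π n a = b := fun a => by
    obtain ⟨l', hl', -⟩ := h [a]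
    -- Convergence at `a` is read off from the list `[a]`; `l'` has length one, so the default 0
    -- never occurs.
    refine ⟨l'.headD 0, hl'.mono fun n hn => ?_⟩
    rw [← hn]
    rfl
  choose ρ hρ using h1
  refine ⟨ρ, hρ, fun l => ?_⟩
  obtain ⟨l', hl', hP⟩ := h l
  rwa [eq_of_eventually_eq (eventually_map_eq hρ l) hl']

/-- Two structures are isomorphic if and only if a limit of elements of a dense group of
permutations carries the colours of the first to those of the second. -/
theorem iso_iff_exists_limit {Γ : Type*} [Group Γ] (τ : Γ →* Equiv.Perm ℕ)
    (hτ : ∀ (π : Equiv.Perm ℕ) (n : ℕ), ∃ γ, ∀ a < n, τ γ a = π a) (M N : Str L') :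
    (∃ δ : ℕ → Γ,
      (∀ l : List ℕ, ∃ l', (∀ᶠ n in atTop, l.map (τ (δ n)) = l') ∧
        ∀ c, l ∈ strColour M c → l' ∈ strColour N c) ∧
      ∀ l : List ℕ, ∃ l', (∀ᶠ n in atTop, l.map (τ (δ n)⁻¹) = l') ∧
        ∀ c, l ∈ strColour N c → l' ∈ strColour M c) ↔ Iso M N := by
  constructor
  · rintro ⟨δ, h1, h2⟩
    obtain ⟨ρ, hρ, hc⟩ := exists_limit h1
    obtain ⟨ρ', hρ', hc'⟩ := exists_limit h2
    -- For one large `n` both limits are attained, by `δ n` and by its inverse.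
    have hl : ∀ a, ρ' (ρ a) = a := fun a => by
      obtain ⟨n, e1, e2⟩ := ((hρ a).and (hρ' (ρ a))).exists
      rw [← e2, ← e1, map_inv]
      exact Equiv.symm_apply_apply _ _
    have hr : ∀ a, ρ (ρ' a) = a := fun a => by
      obtain ⟨n, e1, e2⟩ := ((hρ' a).and (hρ (ρ' a))).exists
      rw [← e2, ← e1, map_inv]
      exact Equiv.apply_symm_apply _ _
    exact iso_of_strColour ⟨ρ, ρ', hl, hr⟩ hc hc'
  · rintro ⟨φ⟩
    let π : Equiv.Perm ℕ := @FirstOrder.Language.Equiv.toEquiv L' ℕ ℕ M N φ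
    -- By density, `δ n` is chosen to agree with the isomorphism below `n`.
    choose δ hδ using hτ π
    have h1 : ∀ a, ∀ᶠ n in atTop, τ (δ n) a = π a := fun a =>
      (eventually_gt_atTop a).mono fun n hn => hδ n a hn
    have h2 : ∀ a, ∀ᶠ n in atTop, τ (δ n)⁻¹ a = π.symm a := fun a =>
      (h1 (π.symm a)).mono fun n hn => by
        rw [Equiv.apply_symm_apply] at hn
        rw [map_inv, Equiv.Perm.inv_eq_iff_eq, hn]
    exact ⟨δ, fun l => ⟨_, eventually_map_eq h1 l, fun c hc => map_mem_strColour φ hc⟩,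
      fun l => ⟨_, eventually_map_eq h2 l,
        fun c hc => map_mem_strColour (@FirstOrder.Language.Equiv.symm L' ℕ ℕ M N φ) hc⟩⟩

/-- The action on lists induced by a homomorphism to a permutation group. -/
abbrev listAction {Γ : Type*} [Group Γ] (τ : Γ →* Equiv.Perm ℕ) : MulAction Γ (List ℕ) where
  smul γ l := l.map (τ γ)
  one_smul l := by
    change l.map (τ 1) = l
    rw [map_one]
    exact List.map_id l
  mul_smul γ δ l := by
    change l.map (τ (γ * δ)) = (l.map (τ δ)).map (τ γ)
    rw [map_mul, List.map_map]
    rfl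

end

end BorelComplexity

theorem mainTheorem8 {R : Type u} [Ring R] [Countable R] [Nontrivial R] :
    BorelComplexity.BorelComplete.{u, 0, u', v'}
      (BorelComplexity.moduleTheory (Polynomial R)) := by
  open BorelComplexity in
  intro L' hL' S _
  obtain ⟨V, _, _, _, ⟨D⟩⟩ := exists_denominatorSystem R
  obtain ⟨Γ, _, _, _, τ, hτ⟩ := exists_countable_group_dense_perm
  let _ := listAction τ
  obtain ⟨k, hk⟩ := exists_injective_nat (CodeTag Γ (List ℕ) L'.Symbols)
  have := countable_polynomial R
  have : Countable (CodeIndex Γ (List ℕ) →₀ V) := inferInstance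
  refine borelReducible_of_submodule (W := CodeIndex Γ (List ℕ) →₀ V)
    (fun M => D.tagModule k (codeTagFun (strColour M))) (fun M => ?_)
    (measurableSet_mem_tagModule D (measurableSet_codeTagFun measurableSet_mem_strColour))
    fun M N => ?_
  · refine Set.infinite_of_injective_forall_mem (f := fun n => Finsupp.single (.grp n 1) D.gen)
      (fun m n h => ?_) fun n => DenominatorSystem.single_gen_mem _
    have := Finsupp.single_left_injective D.gen_ne h
    cases this
    rfl
  · rw [nonempty_codeModule_equiv_iff D hk]
    exact iso_iff_exists_limit τ hτ M N
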